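/- Let $G=\mathrm{GL}_2(\mathbb C)$ with a Haar measure $dg$, let $B\subset G$ be the subgroup of upper triangular matrices, and write $$n(x)=\begin{pmatrix}1&x\\&1\end{pmatrix},\quad t(a)=\begin{pmatrix}a&\\&1\end{pmatrix},\quad z(c)=\begin{pmatrix}c&\\&c\end{pmatrix},\quad w_0=\begin{pmatrix}&1\\1&\end{pmatrix}.$$ For $\nu\in\mathbb C$, $l\in\mathbb Z$ let $\chi_{\nu,l}(z)=|z|^{2\nu}(z/|z|)^l$ on $\mathbb C^\times$. For $\mu\in\mathbb C$ and $m\in\mathbb Z$ let $\pi_{\mu,m}$ be the irreducible quotient of the representation of $G$ unitarily induced from the character $\mathrm{diag}(a,d)\mapsto\chi_{\nu_1,l_1}(a)\chi_{\nu_2,l_2}(d)$ of $B$, where $(\nu_1,\nu_2)=(\mu,-\mu)$, and $(l_1,l_2)=(\frac m2,-\frac m2)$ if $m$ is even, $(l_1,l_2)=(\frac{m+1}2,-\frac{m-1}2)$ if $m$ is odd (the two characters being permuted if $\operatorname{Re}\nu_1<\operatorname{Re}\nu_2$). Its central character is $\omega(c)=1$ if $m$ is even and $\omega(c)=c/|c|$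 if $m$ is odd. For $\lambda\in\mathbb C^\times$ let $\psi(z)=\psi_\lambda(z)=e^{2\pi i(\lambda z+\overline{\lambda z})}$. With $J_\nu$ the classical Bessel function of the first kind, put $J_{\mu,m}(z)=J_{-2\mu-\frac m2}(z)\,J_{-2\mu+\frac m2}(\overline z)$ for $z\in\mathbb C^\times$ (the arguments of $z$ and $\overline z$ being chosen opposite to each other) and $$\boldsymbol J_{\mu,m}(z)=\begin{cases}\dfrac{2\pi^2}{\sin(2\pi\mu)}\left(J_{\mu,m}(4\pi\sqrt z)-J_{-\mu,-m}(4\pi\sqrt z)\right),& m\text{ even},\\[2ex]\dfrac{2\pi^2i}{\cos(2\pi\mu)}\left(J_{\mu,m}(4\pi\sqrt z)+J_{-\mu,-m}(4\pi\sqrt z)\right),& m\text{ odd},\end{cases}$$ replaced by the limit in $\mu$ if $4\mu\in2\mathbb Z+m$. For even $m$ this does not depend on the choice of $\sqrt z$; for odd $m$ it changes sign with $\sqrt z$. The Bessel function $j=j_{\pi,\psi}$ of $\pi=\pi_{\mu,m}$ is the function on $G$ that is zero off the open Bruhat cell $Bw_0B$ and is given on the cell by $$j\big(n(x)z(c)t(a)w_0n(y)\big)=\psi(x)\psi(y)\,\omega(c)\,j(t(a)w_0),\qquad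 x,y\in\mathbb C,\ a,c\in\mathbb C^\times,$$ $$j(t(a)w_0)=\begin{cases}|\lambda a|\,\boldsymbol J_{\mu,m}(-\lambda^2a),& m\text{ even},\\ -i|\lambda|\sqrt{|a|a}\;\boldsymbol J_{\mu,m}(-\lambda^2a),& m\text{ odd},\end{cases}$$ where for odd $m$ one takes $\sqrt{|a|a}=\sqrt{|a|}\sqrt a$ and $\sqrt{-\lambda^2a}=i\lambda\sqrt a$ with the same $\sqrt a$ (the product does not depend on its choice). **Proposition.** If $\pi=\pi_{\mu,m}$ is unitary, then $j$ is locally integrable on $G$; namely, for every $f\in C_c^\infty(G)$, $$\int_G|f(g)\,j(g)|\,dg<\infty .$$ -/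

import Mathlib

open MeasureTheory Filter Topology Matrix
open scoped MatrixGroups ContDiff

namespace BesselGL2

noncomputable section

/-! ### Elements and functions of `GL₂(ℂ)` -/

/-- The upper triangular matrix with diagonal entries `a`, `d` and upper right entry `x`;
these matrices form the Borel subgroup `B`. -/
def borelElt (a d : ℂˣ) (x : ℂ) : GL (Fin 2) ℂ :=
  GeneralLinearGroup.mkOfDetNeZero !![(a : ℂ), x; 0, (d : ℂ)] (by simp)

/-- `n(x)`, the upper triangular unipotent matrix. -/
def nElt (x : ℂ) : GL (Fin 2) ℂ := borelElt 1 1 x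

/-- `t(a) = diag(a, 1)`. -/
def tElt (a : ℂˣ) : GL (Fin 2) ℂ := borelElt a 1 0

/-- `z(c) = diag(c, c)`. -/
def zElt (c : ℂˣ) : GL (Fin 2) ℂ := borelElt c c 0

/-- The Weyl element `w₀`. -/
def wZero : GL (Fin 2) ℂ :=
  GeneralLinearGroup.mkOfDetNeZero !![(0 : ℂ), 1; 1, 0] (by simp)

/-- The open Bruhat cell `X = B w₀ B`. -/
def openCell : Set (GL (Fin 2) ℂ) :=
  {g | ∃ (a d a' d' : ℂˣ) (x x' : ℂ), g = borelElt a d x * wZero * borelElt a' d' x'}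

/-- A function on `GL₂(ℂ)` is smooth if it is a `C^∞` function (in the real sense) of the four
matrix entries on the open set where the determinant does not vanish. -/
def IsSmooth (f : GL (Fin 2) ℂ → ℂ) : Prop :=
  ∃ F : (Fin 2 → Fin 2 → ℂ) → ℂ,
    ContDiffOn ℝ ∞ F {M | (Matrix.of M).det ≠ 0} ∧ ∀ g : GL (Fin 2) ℂ, f g = F (fun i j => g i j)

/-! ### Irreducible unitary representations and the principal series `π_{μ,m}` -/

/-- The character `χ_{ν,l}(z) = ‖z‖^ν (z/|z|)^l` of `ℂˣ`, where `‖z‖ = |z|²`. -/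
def chi (ν : ℂ) (l : ℤ) (z : ℂˣ) : ℂ :=
  ((‖(z : ℂ)‖ ^ 2 : ℝ) : ℂ) ^ ν * ((z : ℂ) / (‖(z : ℂ)‖ : ℂ)) ^ l

/-- The space of the (unitarily) induced representation `Ind_B^G(χ_{ν₁,l₁}, χ_{ν₂,l₂})`, in its
model of continuous functions; note that `‖a/d‖^{1/2} = |a/d|` is the square root of the
modulus character. -/
def inducedSpace (ν₁ : ℂ) (l₁ : ℤ) (ν₂ : ℂ) (l₂ : ℤ) : Submodule ℂ (GL (Fin 2) ℂ → ℂ) where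
  carrier := {φ | Continuous φ ∧ ∀ (a d : ℂˣ) (x : ℂ) (g : GL (Fin 2) ℂ),
    φ (borelElt a d x * g) = chi ν₁ l₁ a * chi ν₂ l₂ d * (‖(a : ℂ) / (d : ℂ)‖ : ℂ) * φ g}
  add_mem' := by
    rintro φ φ' ⟨h1, h2⟩ ⟨h1', h2'⟩
    refine ⟨h1.add h1', fun a d x g => ?_⟩
    simp only [Pi.add_apply, h2, h2', mul_add]
  zero_mem' := ⟨continuous_const, fun a d x g => by simp⟩
  smul_mem' := by
    rintro c φ ⟨h1, h2⟩
    refine ⟨h1.const_smul c, fun a d x g => ?_⟩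
    simp only [Pi.smul_apply, smul_eq_mul, h2]
    ring

/-- The action of `GL₂(ℂ)` on the induced space by right translation,
`(h · φ)(g) = φ(g h)`. -/
def inducedRep (ν₁ : ℂ) (l₁ : ℤ) (ν₂ : ℂ) (l₂ : ℤ) :
    Representation ℂ (GL (Fin 2) ℂ) (inducedSpace ν₁ l₁ ν₂ l₂) where
  toFun h :=
    { toFun := fun φ => ⟨fun g => φ.1 (g * h), φ.2.1.comp (continuous_mul_const h),
        fun a d x g => (congrArg φ.1 (mul_assoc _ _ _)).trans (φ.2.2 a d x (g * h))⟩
      map_add' := fun _ _ => rfl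
      map_smul' := fun _ _ => rfl }
  map_one' := by
    ext φ g
    simp
  map_mul' h h' := by
    ext φ g
    simp [mul_assoc]

section Representations

variable {H : Type*} [NormedAddCommGroup H] [InnerProductSpace ℂ H]

/-- `π` is an irreducible unitary representation of `GL₂(ℂ)` on `H`: the operators `π(g)` are
unitary, `g ↦ π(g) v` is continuous for all `v`, `H` is not zero, and there are no closed
invariant subspaces except `0` and `H`. -/
structure IsIrreducibleUnitary (π : GL (Fin 2) ℂ →* (H ≃ₗᵢ[ℂ] H)) : Prop where
  nontrivial : Nontrivial H
  continuous : ∀ v : H, Continuous fun g => π g v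
  irreducible : ∀ V : Submodule ℂ H, IsClosed (V : Set H) →
    (∀ g, ∀ v ∈ V, π g v ∈ V) → V = ⊥ ∨ V = ⊤

/-- There is a nonzero intertwining operator from `Ind_B^G(χ_{ν₁,l₁}, χ_{ν₂,l₂})` to `π`, bounded
with respect to the supremum norm over the maximal compact subgroup `U(2)`. When `π` is
irreducible unitary this says that `π` is (infinitesimally equivalent to) an irreducible quotient
of the induced representation. -/
def IsQuotientOfInduced (π : GL (Fin 2) ℂ →* (H ≃ₗᵢ[ℂ] H))
    (ν₁ : ℂ) (l₁ : ℤ) (ν₂ : ℂ) (l₂ : ℤ) : Prop :=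
  ∃ T : inducedSpace ν₁ l₁ ν₂ l₂ →ₗ[ℂ] H, T ≠ 0 ∧
    (∃ C : ℝ, ∀ (φ : inducedSpace ν₁ l₁ ν₂ l₂) (R : ℝ),
      (∀ k : GL (Fin 2) ℂ, (k : Matrix (Fin 2) (Fin 2) ℂ) ∈ Matrix.unitaryGroup (Fin 2) ℂ →
        ‖φ.1 k‖ ≤ R) → ‖T φ‖ ≤ C * R) ∧
    ∀ (g : GL (Fin 2) ℂ) (φ : inducedSpace ν₁ l₁ ν₂ l₂),
      T (inducedRep ν₁ l₁ ν₂ l₂ g φ) = π g (T φ)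

/-- `π` is the representation `π(χ_{ν₁,l₁}, χ_{ν₂,l₂})`: the irreducible quotient of the
representation induced from the two characters, which are first permuted, if necessary, so that
the real part of the exponent of the first is at least that of the second. -/
def IsPrincipalSeries (π : GL (Fin 2) ℂ →* (H ≃ₗᵢ[ℂ] H))
    (ν₁ : ℂ) (l₁ : ℤ) (ν₂ : ℂ) (l₂ : ℤ) : Prop :=
  if ν₂.re ≤ ν₁.re then IsQuotientOfInduced π ν₁ l₁ ν₂ l₂
  else IsQuotientOfInduced π ν₂ l₂ ν₁ l₁

/-- `π = π_{μ,m}`: the principal series with exponents `(μ, -μ)` and with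
`(l₁, l₂) = (m/2, -m/2)` for even `m`, `(l₁, l₂) = ((m+1)/2, -(m-1)/2)` for odd `m`. -/
def IsPi (π : GL (Fin 2) ℂ →* (H ≃ₗᵢ[ℂ] H)) (μ : ℂ) (m : ℤ) : Prop :=
  if Even m then IsPrincipalSeries π μ (m / 2) (-μ) (-(m / 2))
  else IsPrincipalSeries π μ ((m + 1) / 2) (-μ) (-((m - 1) / 2))

end Representations

/-! ### Bessel functions of a complex variable -/

/-- The classical Bessel function `J_ν(z) = ∑ (-1)^k (z/2)^{ν+2k} / (k! Γ(ν+k+1))`, as a function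
of a logarithm `w` of `z` (so that `(z/2)^s = exp(s (w - log 2))`). Here `1/Γ` is zero
at the poles of `Γ`, in agreement with `Complex.Gamma` being zero there. -/
def besselJLog (ν w : ℂ) : ℂ :=
  ∑' k : ℕ, (-1) ^ k / ((k.factorial : ℂ) * Complex.Gamma (ν + k + 1)) *
    Complex.exp ((ν + 2 * k) * (w - Complex.log 2))

/-- `J_{μ,m}(z) = J_{-2μ-m/2}(z) J_{-2μ+m/2}(z̄)`, where the arguments of `z` and `z̄` are chosen
opposite to each other. -/
def besselJPair (μ : ℂ) (m : ℤ) (z : ℂ) : ℂ :=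
  besselJLog (-2 * μ - m / 2) (Complex.log z) *
    besselJLog (-2 * μ + m / 2) (starRingEnd ℂ (Complex.log z))

/-- The quotient defining `𝑱_{μ,m}(s²)` for generic `μ`, with `s` as the square root of `s²`. -/
def besselGeneric (μ : ℂ) (m : ℤ) (s : ℂ) : ℂ :=
  if Even m then
    2 * Real.pi ^ 2 / Complex.sin (2 * Real.pi * μ) *
      (besselJPair μ m (4 * Real.pi * s) - besselJPair (-μ) (-m) (4 * Real.pi * s))
  else
    2 * Real.pi ^ 2 * Complex.I / Complex.cos (2 * Real.pi * μ) *
      (besselJPair μ m (4 * Real.pi * s) + besselJPair (-μ) (-m) (4 * Real.pi * s))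

open scoped Classical in
/-- `𝑱_{μ,m}(s²)`, with `s` as the square root of `s²` (for even `m` the value depends only
on `s²`, for odd `m` it changes sign with `s`); in the nongeneric case `4μ ∈ 2ℤ + m` it is the
limit of the generic expression. -/
def besselAtRoot (μ : ℂ) (m : ℤ) (s : ℂ) : ℂ :=
  if ∃ k : ℤ, 4 * μ = 2 * k + m then limUnder (𝓝[≠] μ) (fun μ' => besselGeneric μ' m s)
  else besselGeneric μ m s

/-- The Bessel function `𝑱_{μ,m}(z)`, with the principal square root of `z`. -/
def besselBold (μ : ℂ) (m : ℤ) (z : ℂ) : ℂ := besselAtRoot μ m (z ^ (1 / 2 : ℂ))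

/-! ### The Bessel function of `π_{μ,m}` -/

/-- The additive character `ψ_λ(z) = e(λz + conj(λz))`, `e(x) = exp(2πix)`. -/
def psi (lam z : ℂ) : ℂ :=
  Complex.exp (2 * Real.pi * Complex.I * (lam * z + starRingEnd ℂ (lam * z)))

/-- The central character of `π_{μ,m}`: trivial for even `m`, and `c ↦ c/|c|` for odd `m`. -/
def omega (m : ℤ) (c : ℂ) : ℂ := if Even m then 1 else c / (‖c‖ : ℂ)

/-- The value `j(t(a) w₀)`. It is `|λa| 𝑱_{μ,m}(-λ²a)` for even `m` and
`-i |λ| √(|a|a) 𝑱_{μ,m}(-λ²a)` for odd `m`. For odd `m` the square root of `-λ²a`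
that enters `𝑱_{μ,m}` is `iλ√a`, with the same `√a` as in `√(|a|a) = √|a| √a`; the product does not
depend on the choice of `√a`. -/
def besselTorus (μ : ℂ) (m : ℤ) (lam a : ℂ) : ℂ :=
  if Even m then (‖lam * a‖ : ℂ) * besselBold μ m (-lam ^ 2 * a)
  else -Complex.I * (‖lam‖ : ℂ) * ((Real.sqrt ‖a‖ : ℂ) * a ^ (1 / 2 : ℂ)) *
    besselAtRoot μ m (Complex.I * lam * a ^ (1 / 2 : ℂ))

/-- The Bessel function `j_{π,ψ}` on `GL₂(ℂ)` for `π = π_{μ,m}` and `ψ = ψ_λ`. A matrix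
`g = (p q; r s)` lies in the open Bruhat cell if and only if `r ≠ 0`, and then
`g = n(p/r) z(r) t(-det g / r²) w₀ n(s/r)`; off the cell `j` is zero. -/
def besselFn (μ : ℂ) (m : ℤ) (lam : ℂ) (g : GL (Fin 2) ℂ) : ℂ :=
  if g 1 0 = 0 then 0
  else psi lam (g 0 0 / g 1 0) * psi lam (g 1 1 / g 1 0) * omega m (g 1 0) *
    besselTorus μ m lam (-(g : Matrix (Fin 2) (Fin 2) ℂ).det / (g 1 0) ^ 2)

/-- The cell `B w₀ B` consists of the matrices whose lower left entry is not zero. -/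
theorem mem_openCell_iff (g : GL (Fin 2) ℂ) : g ∈ openCell ↔ g 1 0 ≠ 0 := by
  constructor
  · rintro ⟨a, d, a', d', x, x', rfl⟩
    simp [borelElt, wZero, GeneralLinearGroup.mkOfDetNeZero, Matrix.mul_apply, Fin.sum_univ_two]
  · intro h
    have hd : (g : Matrix (Fin 2) (Fin 2) ℂ).det ≠ 0 := g.det_ne_zero
    refine ⟨Units.mk0 (-(g : Matrix (Fin 2) (Fin 2) ℂ).det / g 1 0)
      (div_ne_zero (neg_ne_zero.mpr hd) h), Units.mk0 (g 1 0) h, 1, 1, g 0 0, g 1 1 / g 1 0, ?_⟩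
    ext i j
    fin_cases i <;> fin_cases j <;>
      simp [borelElt, wZero, GeneralLinearGroup.mkOfDetNeZero, Matrix.mul_apply,
        Fin.sum_univ_two, Matrix.det_fin_two] <;> field_simp
    ring

/-- `j` vanishes off the open Bruhat cell. -/
theorem besselFn_of_notMem (μ : ℂ) (m : ℤ) (lam : ℂ) (g : GL (Fin 2) ℂ) (hg : g ∉ openCell) :
    besselFn μ m lam g = 0 := by
  rw [mem_openCell_iff, not_not] at hg
  simp [besselFn, hg]

/-- `j(n(x) z(c) t(a) w₀ n(y)) = ψ(x) ψ(y) ω(c) j(t(a) w₀)`. -/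
theorem besselFn_bruhat (μ : ℂ) (m : ℤ) (lam x y : ℂ) (c a : ℂˣ) :
    besselFn μ m lam (nElt x * zElt c * tElt a * wZero * nElt y) =
      psi lam x * psi lam y * omega m c * besselTorus μ m lam a := by
  have hc : (c : ℂ) ≠ 0 := c.ne_zero
  have e00 : (nElt x * zElt c * tElt a * wZero * nElt y) 0 0 = x * c := by
    simp [nElt, zElt, tElt, borelElt, wZero, GeneralLinearGroup.mkOfDetNeZero, Matrix.mul_apply,
      Fin.sum_univ_two]
  have e10 : (nElt x * zElt c * tElt a * wZero * nElt y) 1 0 = (c : ℂ) := by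
    simp [nElt, zElt, tElt, borelElt, wZero, GeneralLinearGroup.mkOfDetNeZero, Matrix.mul_apply,
      Fin.sum_univ_two]
  have e11 : (nElt x * zElt c * tElt a * wZero * nElt y) 1 1 = c * y := by
    simp [nElt, zElt, tElt, borelElt, wZero, GeneralLinearGroup.mkOfDetNeZero, Matrix.mul_apply,
      Fin.sum_univ_two]
  have ed : ((nElt x * zElt c * tElt a * wZero * nElt y : GL (Fin 2) ℂ) :
      Matrix (Fin 2) (Fin 2) ℂ).det = -(c : ℂ) ^ 2 * a := by
    simp [nElt, zElt, tElt, borelElt, wZero, GeneralLinearGroup.mkOfDetNeZero]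
    ring
  rw [besselFn, e00, e10, e11, ed, if_neg hc, mul_div_cancel_right₀ _ hc,
    mul_div_cancel_left₀ _ hc]
  congr 2
  field_simp

end

end BesselGL2

namespace BesselGL2

/-! ### The power series of the Bessel function of the first kind -/

/-! Write `r` for the lower left entry of `g` and `a = -det g / r²`. On the open cell `|j(g)|` is at
most `|j(t(a)w₀)|`, because `|ψ| = 1` and `|ω| ≤ 1`. On a compact set `|det g|` is bounded above and
below and `|r|` is bounded above, so `|a|` stays away from `0` and is comparable to `|r|⁻²`. Hence
only the size of the Bessel function at infinity matters. If `besselAtRoot` at `s` is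
`O(|s|^(-1/2))`, then `j(t(a)w₀) = O(|a|^(3/4))` and `j(g) = O(|r|^(-3/2))`
(`exists_norm_besselFn_le`). This is locally integrable since `r` varies in two real dimensions and
`3/2 < 2`; mere boundedness would give only `|r|⁻²`, the divergent borderline.

The decay comes from a cancellation. With `z = 4πs`, each product of two `J`'s can grow like
`exp(2|Im z|)`. For `Im z > 0`, the connection formulas express `J_{-ν}` through `J_ν` and the
decaying function `K_ν`. In the combination defining `besselAtRoot` the purely growing terms cancel,
together with the denominator `sin(2πμ)` or `cos(2πμ)`. What remains is `besselHankel`, a sum of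
products of one `J` and one `K` (`exists_besselAtRoot_eq`), continuous in `μ`, so that the
exceptional limits are covered too. An energy estimate gives `|J| ≤ C |z|^(-1/2) exp|Im z|` and the
integral representation with Grönwall gives `|K| ≤ C exp(-Im z)` at the arguments that occur; the
exponentials cancel. Conjugation covers the lower half plane, and real `s` come only from a null set
of `g`.

The Haar measure enters only through left invariance: averaging over lower unipotent translations
moves `r` through a disc, which reduces local integrability of `|r|^(-3/2)` on the group to that on
`ℂ` (`exists_nhds_setLIntegral_entry_rpow_lt_top`). -/

/-- The `k`-th term of the series `besselJLog`. -/
noncomputable def besselTerm (ν : ℂ) (k : ℕ) (w : ℂ) : ℂ :=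
  (-1) ^ k / ((k.factorial : ℂ) * Complex.Gamma (ν + k + 1)) *
    Complex.exp ((ν + 2 * k) * (w - Complex.log 2))

/-- Once `k ≥ N ≥ M`, the factor in `1/Γ(s) = s/Γ(s+1)` at `s = ν + k + 1` has modulus at least `1`,
so the reciprocals no longer increase with `k`; compactness handles the finitely many smaller `k`.
-/
theorem exists_norm_inv_Gamma_le (M : ℝ) :
    ∃ C : ℝ, 0 ≤ C ∧ ∀ ν : ℂ, ‖ν‖ ≤ M → ∀ k : ℕ, ‖(Complex.Gamma (ν + k + 1))⁻¹‖ ≤ C := by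
  obtain ⟨N, hN⟩ := exists_nat_ge M
  have hcont : ∀ k : ℕ, Continuous fun ν : ℂ => (Complex.Gamma (ν + k + 1))⁻¹ := fun k =>
    Complex.differentiable_one_div_Gamma.continuous.comp (by fun_prop : Continuous fun ν : ℂ =>
      ν + k + 1)
  obtain ⟨C, hC⟩ := (isCompact_closedBall (0 : ℂ) M).exists_bound_of_continuousOn
    (f := fun ν : ℂ => ∑ k ∈ Finset.range (N + 1), ‖(Complex.Gamma (ν + k + 1))⁻¹‖)
    (continuous_finsetSum _ fun k _ => (hcont k).norm).continuousOn
  have hsmall : ∀ ν : ℂ, ‖ν‖ ≤ M → ∀ k ≤ N, ‖(Complex.Gamma (ν + k + 1))⁻¹‖ ≤ C := by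
    intro ν hν k hk
    have h1 := hC ν (by simpa using hν)
    rw [Real.norm_of_nonneg (Finset.sum_nonneg fun _ _ => norm_nonneg _)] at h1
    exact (Finset.single_le_sum (f := fun k : ℕ => ‖(Complex.Gamma (ν + k + 1))⁻¹‖)
      (fun _ _ => norm_nonneg _) (Finset.mem_range.2 (Nat.lt_succ_of_le hk))).trans h1
  refine ⟨max C 0, le_max_right _ _, fun ν hν k => le_trans ?_ (le_max_left C 0)⟩
  rcases le_total k N with hk | hk
  · exact hsmall ν hν k hk
  · induction k, hk using Nat.le_induction with
    | base => exact hsmall ν hν N le_rfl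
    | succ k hk ih =>
      have hrec := Complex.one_div_Gamma_eq_self_mul_one_div_Gamma_add_one (ν + k + 1)
      have h1 : 1 ≤ ‖ν + k + 1‖ := by
        have h2 : ‖((k : ℂ) + 1)‖ = k + 1 := by
          rw [← Nat.cast_add_one, Complex.norm_natCast]; simp
        have h3 : ‖((k : ℂ) + 1)‖ ≤ ‖ν + k + 1‖ + ‖ν‖ := by
          have := norm_sub_le (ν + k + 1) ν
          rwa [show ν + k + 1 - ν = (k : ℂ) + 1 by ring] at this
        have h4 : (N : ℝ) ≤ k := by exact_mod_cast hk
        linarith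
      rw [hrec, norm_mul] at ih
      push_cast
      rw [show ν + ((k : ℂ) + 1) + 1 = ν + k + 1 + 1 by ring]
      exact (le_mul_of_one_le_left (norm_nonneg _) h1).trans ih

theorem exists_norm_besselTerm_le (M ρ : ℝ) :
    ∃ u : ℕ → ℝ, Summable u ∧ ∀ ν : ℂ, ‖ν‖ ≤ M → ∀ w : ℂ, ‖w - Complex.log 2‖ ≤ ρ →
      ∀ k : ℕ, ‖besselTerm ν k w‖ ≤ u k := by
  obtain ⟨C, hC0, hC⟩ := exists_norm_inv_Gamma_le M
  refine ⟨fun k => C * Real.exp (M * ρ) * (Real.exp (2 * ρ) ^ k / k.factorial),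
    (Real.summable_pow_div_factorial _).mul_left _, fun ν hν w hw k => ?_⟩
  have hM : 0 ≤ M := (norm_nonneg _).trans hν
  have hexp : ‖Complex.exp ((ν + 2 * k) * (w - Complex.log 2))‖ ≤
      Real.exp (M * ρ) * Real.exp (2 * ρ) ^ k := by
    refine (Complex.norm_exp_le_exp_norm _).trans ?_
    rw [← Real.exp_nat_mul, ← Real.exp_add, Real.exp_le_exp, norm_mul]
    have : ‖ν + 2 * k‖ ≤ M + 2 * k := by
      refine (norm_add_le _ _).trans (add_le_add hν ?_)
      simp
    calc ‖ν + 2 * k‖ * ‖w - Complex.log 2‖ ≤ (M + 2 * k) * ρ :=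
          mul_le_mul this hw (norm_nonneg _) (by positivity)
      _ = _ := by ring
  have hcoef : ‖(-1 : ℂ) ^ k / ((k.factorial : ℂ) * Complex.Gamma (ν + k + 1))‖ ≤
      C / k.factorial := by
    rw [norm_div, norm_mul, norm_pow, norm_neg, norm_one, one_pow, Complex.norm_natCast,
      one_div, mul_inv, ← norm_inv, mul_comm, div_eq_mul_inv]
    exact mul_le_mul_of_nonneg_right (hC ν hν k) (by positivity)
  rw [besselTerm, norm_mul]
  calc _ ≤ C / k.factorial * (Real.exp (M * ρ) * Real.exp (2 * ρ) ^ k) :=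
        mul_le_mul hcoef hexp (norm_nonneg _) (by positivity)
    _ = _ := by ring

theorem summable_besselTerm (ν w : ℂ) : Summable fun k => besselTerm ν k w := by
  obtain ⟨u, hu, h⟩ := exists_norm_besselTerm_le ‖ν‖ ‖w - Complex.log 2‖
  exact Summable.of_norm_bounded hu (h ν le_rfl w le_rfl)

theorem hasSum_besselTerm (ν w : ℂ) : HasSum (fun k => besselTerm ν k w) (besselJLog ν w) :=
  (summable_besselTerm ν w).hasSum

/-- Regularity in the order is what evaluates the limit in `μ` at the exceptional parameters. -/
theorem differentiable_besselJLog_order (w : ℂ) : Differentiable ℂ fun ν => besselJLog ν w := by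
  intro ν
  obtain ⟨u, hu, h⟩ := exists_norm_besselTerm_le (‖ν‖ + 1) ‖w - Complex.log 2‖
  have hd : DifferentiableOn ℂ (fun ν => ∑' k, besselTerm ν k w) (Metric.ball 0 (‖ν‖ + 1)) := by
    refine Complex.differentiableOn_tsum_of_summable_norm hu (fun k => ?_) Metric.isOpen_ball
      fun k ν' hν' => h ν' (by simpa using (Metric.mem_ball.1 hν').le) w le_rfl k
    have h1 : Differentiable ℂ fun ν : ℂ => (Complex.Gamma (ν + k + 1))⁻¹ :=
      Complex.differentiable_one_div_Gamma.comp (by fun_prop)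
    simp only [besselTerm, div_eq_mul_inv, mul_inv]
    fun_prop
  exact hd.differentiableAt (Metric.isOpen_ball.mem_nhds (by simp))

theorem hasDerivAt_besselTerm (ν : ℂ) (k : ℕ) (w : ℂ) :
    HasDerivAt (besselTerm ν k) ((ν + 2 * k) * besselTerm ν k w) w := by
  have h1 : HasDerivAt (fun w : ℂ => (ν + 2 * k) * (w - Complex.log 2)) ((ν + 2 * k) * 1) w :=
    ((hasDerivAt_id w).sub_const _).const_mul _
  convert! h1.cexp.const_mul
    ((-1) ^ k / ((k.factorial : ℂ) * Complex.Gamma (ν + k + 1))) using 1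
  rw [besselTerm]; ring

theorem exists_hasDerivAt_besselJLog (ν w : ℂ) : ∃ D, HasDerivAt (besselJLog ν) D w ∧
    HasSum (fun k => (ν + 2 * k) * besselTerm ν k w) D := by
  obtain ⟨u, hu, h⟩ := exists_norm_besselTerm_le ‖ν‖ (‖w - Complex.log 2‖ + 1)
  have hd : ∀ k, DifferentiableOn ℂ (besselTerm ν k)
      (Metric.ball (Complex.log 2) (‖w - Complex.log 2‖ + 1)) := fun k w _ =>
    (hasDerivAt_besselTerm ν k w).differentiableAt.differentiableWithinAt
  have hb : ∀ k, ∀ w' ∈ Metric.ball (Complex.log 2) (‖w - Complex.log 2‖ + 1),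
      ‖besselTerm ν k w'‖ ≤ u k := fun k w' hw' =>
    h ν le_rfl w' (by simpa [dist_eq_norm] using (Metric.mem_ball.1 hw').le) k
  have hw : w ∈ Metric.ball (Complex.log 2) (‖w - Complex.log 2‖ + 1) := by
    simp [dist_eq_norm]
  refine ⟨_, ((Complex.differentiableOn_tsum_of_summable_norm hu hd Metric.isOpen_ball
    hb).differentiableAt (Metric.isOpen_ball.mem_nhds hw)).hasDerivAt, ?_⟩
  have := Complex.hasSum_deriv_of_summable_norm hu hd Metric.isOpen_ball hb hw
  simpa only [(hasDerivAt_besselTerm ν _ w).deriv] using this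

/-- The factor `k` kills the term `k = 0` and turns `k!` into `(k-1)!`; shifting the index leaves
the series of order `ν + 1`. -/
theorem hasSum_two_mul_besselTerm (ν w : ℂ) :
    HasSum (fun k : ℕ => 2 * k * besselTerm ν k w) (-(Complex.exp w * besselJLog (ν + 1) w)) := by
  have h1 := (hasSum_besselTerm (ν + 1) w).mul_left (-Complex.exp w)
  rw [← hasSum_nat_add_iff' 1]
  simp only [Finset.range_one, Finset.sum_singleton, Nat.cast_zero, mul_zero, zero_mul, sub_zero]
  rw [← neg_mul]
  convert! h1 using 2 with k
  have hk : ((k : ℂ) + 1) ≠ 0 := Nat.cast_add_one_ne_zero k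
  have hf : (k.factorial : ℂ) ≠ 0 := Nat.cast_ne_zero.2 k.factorial_ne_zero
  have he : Complex.exp ((ν + 2 * ((k : ℂ) + 1)) * (w - Complex.log 2)) =
      Complex.exp w / 2 * Complex.exp ((ν + 1 + 2 * k) * (w - Complex.log 2)) := by
    rw [show Complex.exp w / 2 = Complex.exp (w - Complex.log 2) by
      rw [Complex.exp_sub, Complex.exp_log two_ne_zero], ← Complex.exp_add]
    congr 1; ring
  simp only [besselTerm, Nat.factorial_succ]
  push_cast
  rw [he, show ν + ((k : ℂ) + 1) + 1 = ν + 1 + k + 1 by ring, pow_succ]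
  simp only [div_eq_mul_inv, mul_inv]
  field_simp

/-- Here `ν + k` is absorbed into the Gamma factor, `(ν+k)/Γ(ν+k+1) = 1/Γ(ν+k)`, which lowers the
order. -/
theorem hasSum_order_add_besselTerm (ν w : ℂ) :
    HasSum (fun k : ℕ => 2 * (ν + k) * besselTerm ν k w)
      (Complex.exp w * besselJLog (ν - 1) w) := by
  convert! (hasSum_besselTerm (ν - 1) w).mul_left (Complex.exp w) using 2 with k
  have he : Complex.exp ((ν + 2 * (k : ℂ)) * (w - Complex.log 2)) =
      Complex.exp w / 2 * Complex.exp ((ν - 1 + 2 * k) * (w - Complex.log 2)) := by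
    rw [show Complex.exp w / 2 = Complex.exp (w - Complex.log 2) by
      rw [Complex.exp_sub, Complex.exp_log two_ne_zero], ← Complex.exp_add]
    congr 1; ring
  have hg := Complex.one_div_Gamma_eq_self_mul_one_div_Gamma_add_one (ν + k)
  simp only [besselTerm]
  rw [he, show ν - 1 + (k : ℂ) + 1 = ν + k by ring]
  simp only [div_eq_mul_inv, mul_inv, hg]
  ring

theorem hasDerivAt_besselJLog (ν w : ℂ) :
    HasDerivAt (besselJLog ν) (ν * besselJLog ν w - Complex.exp w * besselJLog (ν + 1) w) w := by
  obtain ⟨D, hD, hs⟩ := exists_hasDerivAt_besselJLog ν w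
  have h := ((hasSum_besselTerm ν w).mul_left ν).add (hasSum_two_mul_besselTerm ν w)
  rw [sub_eq_add_neg]
  convert! hD
  refine h.unique ?_
  convert! hs using 2
  ring

theorem besselJLog_recurrence (ν w : ℂ) :
    2 * ν * besselJLog ν w =
      Complex.exp w * (besselJLog (ν - 1) w + besselJLog (ν + 1) w) := by
  have h := (hasSum_order_add_besselTerm ν w).sub (hasSum_two_mul_besselTerm ν w)
  have h' := (hasSum_besselTerm ν w).mul_left (2 * ν)
  rw [show Complex.exp w * (besselJLog (ν - 1) w + besselJLog (ν + 1) w) =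
    Complex.exp w * besselJLog (ν - 1) w - -(Complex.exp w * besselJLog (ν + 1) w) by ring]
  refine h'.unique ?_
  convert! h using 2
  ring

theorem besselJLog_add_pi_mul_I (ν w : ℂ) :
    besselJLog ν (w + Real.pi * Complex.I) =
      Complex.exp (Real.pi * Complex.I * ν) * besselJLog ν w := by
  refine (hasSum_besselTerm ν _).unique ?_
  convert! (hasSum_besselTerm ν w).mul_left (Complex.exp (Real.pi * Complex.I * ν)) using 2 with k
  simp only [besselTerm]
  have : Complex.exp ((ν + 2 * k) * (w + Real.pi * Complex.I - Complex.log 2)) =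
      Complex.exp (Real.pi * Complex.I * ν) *
        Complex.exp ((ν + 2 * k) * (w - Complex.log 2)) := by
    rw [← Complex.exp_add, ← Complex.exp_periodic.nat_mul k
      (Real.pi * Complex.I * ν + (ν + 2 * k) * (w - Complex.log 2))]
    congr 1; ring
  rw [this]; ring

/-! ### The Bessel function of the third kind -/

/-- The integral `∫ exp(-ζ cosh t + ν t) dt` over the real line, which is `2 K_ν(ζ)` for
`Re ζ > 0`. -/
noncomputable def besselK (ν ζ : ℂ) : ℂ :=
  ∫ t : ℝ, Complex.exp (-ζ * Real.cosh t + ν * t)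

/-- Supplies a Gaussian majorant for the integrands of `besselK`. -/
theorem one_add_sq_div_four_le_cosh (t : ℝ) : 1 + t ^ 2 / 4 ≤ Real.cosh t := by
  have h1 := Real.quadratic_le_exp_of_nonneg (abs_nonneg t)
  have h2 := Real.add_one_le_exp (-|t|)
  rw [← Real.cosh_abs, Real.cosh_eq]
  rw [sq_abs] at h1
  linarith

theorem norm_besselK_integrand (ν ζ : ℂ) (t : ℝ) :
    ‖Complex.exp (-ζ * Real.cosh t + ν * t)‖ = Real.exp (-ζ.re * Real.cosh t + ν.re * t) := by
  rw [Complex.norm_exp]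
  simp only [Complex.add_re, Complex.re_mul_ofReal, Complex.neg_re]

theorem integrable_exp_neg_mul_cosh {y : ℝ} (hy : 0 < y) (a : ℝ) :
    Integrable fun t : ℝ => Real.exp (-y * Real.cosh t + a * t) := by
  have h := (integrable_cexp_quadratic (b := ((y / 4 : ℝ) : ℂ)) (by
    rw [Complex.ofReal_re]; positivity) a 0).norm
  refine h.mono' (by fun_prop) (Eventually.of_forall fun t => ?_)
  rw [Complex.norm_exp, Real.norm_of_nonneg (Real.exp_pos _).le, Real.exp_le_exp]
  have h1 : (-((y / 4 : ℝ) : ℂ) * (t : ℂ) ^ 2 + (a : ℂ) * t + 0).re = -(y / 4) * t ^ 2 + a * t := by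
    norm_cast
    rw [add_zero]
  rw [h1]
  nlinarith [one_add_sq_div_four_le_cosh t]

theorem aestronglyMeasurable_besselK_integrand (ν ζ : ℂ) :
    AEStronglyMeasurable (fun t : ℝ => Complex.exp (-ζ * Real.cosh t + ν * t)) volume := by
  refine Continuous.aestronglyMeasurable ?_
  have := Real.continuous_cosh
  fun_prop

theorem integrable_besselK_integrand (ν : ℂ) {ζ : ℂ} (hζ : 0 < ζ.re) :
    Integrable fun t : ℝ => Complex.exp (-ζ * Real.cosh t + ν * t) := by
  refine (integrable_exp_neg_mul_cosh hζ ν.re).mono'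
    (aestronglyMeasurable_besselK_integrand ν ζ) (Eventually.of_forall fun t => ?_)
  rw [norm_besselK_integrand]

theorem besselK_neg (ν ζ : ℂ) : besselK (-ν) ζ = besselK ν ζ := by
  rw [besselK, besselK, ← integral_neg_eq_self]
  simp

theorem cosh_mul_besselK_integrand (ν ζ : ℂ) (t : ℝ) :
    (Real.cosh t : ℂ) * Complex.exp (-ζ * Real.cosh t + ν * t) =
      (Complex.exp (-ζ * Real.cosh t + (ν + 1) * t) +
        Complex.exp (-ζ * Real.cosh t + (ν - 1) * t)) / 2 := by
  have h1 : (Real.cosh t : ℂ) = (Complex.exp t + Complex.exp (-t)) / 2 := by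
    rw [Complex.ofReal_cosh, Complex.cosh]
  rw [show -ζ * Real.cosh t + (ν + 1) * t = (-ζ * Real.cosh t + ν * t) + t by ring,
    show -ζ * Real.cosh t + (ν - 1) * t = (-ζ * Real.cosh t + ν * t) + -t by ring,
    Complex.exp_add _ (t : ℂ), Complex.exp_add _ (-t : ℂ)]
  generalize Complex.exp (-ζ * Real.cosh t + ν * t) = A
  rw [h1]; ring

theorem sinh_mul_besselK_integrand (ν ζ : ℂ) (t : ℝ) :
    (Real.sinh t : ℂ) * Complex.exp (-ζ * Real.cosh t + ν * t) =
      (Complex.exp (-ζ * Real.cosh t + (ν + 1) * t) -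
        Complex.exp (-ζ * Real.cosh t + (ν - 1) * t)) / 2 := by
  have h1 : (Real.sinh t : ℂ) = (Complex.exp t - Complex.exp (-t)) / 2 := by
    rw [Complex.ofReal_sinh, Complex.sinh]
  rw [show -ζ * Real.cosh t + (ν + 1) * t = (-ζ * Real.cosh t + ν * t) + t by ring,
    show -ζ * Real.cosh t + (ν - 1) * t = (-ζ * Real.cosh t + ν * t) + -t by ring,
    Complex.exp_add _ (t : ℂ), Complex.exp_add _ (-t : ℂ)]
  generalize Complex.exp (-ζ * Real.cosh t + ν * t) = A
  rw [h1]; ring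

/-- The integral over `ℝ` of the `t`-derivative of the integrand vanishes. -/
theorem besselK_recurrence (ν : ℂ) {ζ : ℂ} (hζ : 0 < ζ.re) :
    2 * ν * besselK ν ζ = ζ * (besselK (ν + 1) ζ - besselK (ν - 1) ζ) := by
  have h0 := integrable_besselK_integrand ν hζ
  have h1 := integrable_besselK_integrand (ν + 1) hζ
  have h2 := integrable_besselK_integrand (ν - 1) hζ
  have h12 : Integrable fun t : ℝ => ζ / 2 * (Complex.exp (-ζ * Real.cosh t + (ν + 1) * t) -
      Complex.exp (-ζ * Real.cosh t + (ν - 1) * t)) := (h1.sub h2).const_mul (ζ / 2)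
  have hd : ∀ t : ℝ, HasDerivAt (fun t : ℝ => Complex.exp (-ζ * Real.cosh t + ν * t))
      (ν * Complex.exp (-ζ * Real.cosh t + ν * t) -
        ζ / 2 * (Complex.exp (-ζ * Real.cosh t + (ν + 1) * t) -
          Complex.exp (-ζ * Real.cosh t + (ν - 1) * t))) t := by
    intro t
    have hc : HasDerivAt (fun t : ℝ => (Real.cosh t : ℂ)) (Real.sinh t : ℂ) t :=
      (Real.hasDerivAt_cosh t).ofReal_comp
    have hi : HasDerivAt (fun t : ℝ => (t : ℂ)) 1 t := by
      simpa using (hasDerivAt_id t).ofReal_comp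
    convert! ((hc.const_mul (-ζ)).add (hi.const_mul ν)).cexp using 1
    linear_combination ζ * sinh_mul_besselK_integrand ν ζ t
  have h := integral_eq_zero_of_hasDerivAt_of_integrable hd
    ((h0.const_mul ν).sub ((h1.sub h2).const_mul (ζ / 2))) h0
  rw [integral_sub (h0.const_mul ν) h12, integral_const_mul,
    integral_const_mul, integral_sub h1 h2] at h
  simp only [besselK]
  linear_combination 2 * h

theorem hasDerivAt_besselK' (ν : ℂ) {ζ : ℂ} (hζ : 0 < ζ.re) :
    HasDerivAt (besselK ν) (-(besselK (ν + 1) ζ + besselK (ν - 1) ζ) / 2) ζ := by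
  have hy : 0 < ζ.re / 2 := by positivity
  have hs : {z : ℂ | ζ.re / 2 < z.re} ∈ 𝓝 ζ :=
    (isOpen_lt continuous_const Complex.continuous_re).mem_nhds (half_lt_self hζ)
  have key := hasDerivAt_integral_of_dominated_loc_of_deriv_le (μ := volume) (𝕜 := ℂ) hs
    (F := fun z (t : ℝ) => Complex.exp (-z * Real.cosh t + ν * t))
    (F' := fun z (t : ℝ) => -(Complex.exp (-z * Real.cosh t + (ν + 1) * t) +
        Complex.exp (-z * Real.cosh t + (ν - 1) * t)) / 2)
    (bound := fun t => (Real.exp (-(ζ.re / 2) * Real.cosh t + (ν + 1).re * t) +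
      Real.exp (-(ζ.re / 2) * Real.cosh t + (ν - 1).re * t)) / 2)
    (Eventually.of_forall fun z => aestronglyMeasurable_besselK_integrand ν z)
    (integrable_besselK_integrand ν hζ)
    (((integrable_besselK_integrand (ν + 1) hζ).add
      (integrable_besselK_integrand (ν - 1) hζ)).neg.div_const 2).aestronglyMeasurable
    (Eventually.of_forall fun t z hz => ?_)
    (((integrable_exp_neg_mul_cosh hy _).add (integrable_exp_neg_mul_cosh hy _)).div_const 2)
    (Eventually.of_forall fun t z hz => ?_)
  · convert! key.2 using 1
    rw [besselK, besselK, ← integral_add (integrable_besselK_integrand _ hζ)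
      (integrable_besselK_integrand _ hζ), ← integral_neg, ← integral_div]
  · rw [norm_div, norm_neg, Complex.norm_ofNat]
    refine div_le_div_of_nonneg_right ((norm_add_le _ _).trans ?_) zero_le_two
    rw [norm_besselK_integrand, norm_besselK_integrand]
    have h1 : -z.re * Real.cosh t ≤ -(ζ.re / 2) * Real.cosh t :=
      mul_le_mul_of_nonneg_right (neg_le_neg (le_of_lt hz)) (Real.cosh_pos t).le
    gcongr
  · have hi : HasDerivAt (fun z : ℂ => -z * Real.cosh t + ν * t) (-1 * Real.cosh t) z :=
      (((hasDerivAt_id z).neg).mul_const _).add_const _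
    convert! hi.cexp using 1
    linear_combination cosh_mul_besselK_integrand ν z t

theorem hasDerivAt_besselK (ν : ℂ) {ζ : ℂ} (hζ : 0 < ζ.re) :
    HasDerivAt (besselK ν) (ν / ζ * besselK ν ζ - besselK (ν + 1) ζ) ζ := by
  have h0 : ζ ≠ 0 := by rintro rfl; simp at hζ
  convert! hasDerivAt_besselK' ν hζ using 1
  field_simp
  linear_combination besselK_recurrence ν hζ

theorem hasDerivAt_besselK_add_one (ν : ℂ) {ζ : ℂ} (hζ : 0 < ζ.re) :
    HasDerivAt (besselK (ν + 1)) (-besselK ν ζ - (ν + 1) / ζ * besselK (ν + 1) ζ) ζ := by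
  have h0 : ζ ≠ 0 := by rintro rfl; simp at hζ
  convert! hasDerivAt_besselK' (ν + 1) hζ using 1
  have := besselK_recurrence (ν + 1) hζ
  rw [add_sub_cancel_right] at this ⊢
  field_simp
  linear_combination -this

theorem continuous_besselK_order {ζ : ℂ} (hζ : 0 < ζ.re) : Continuous fun ν => besselK ν ζ := by
  rw [continuous_iff_continuousAt]
  intro ν
  refine continuousAt_of_dominated (bound := fun t =>
    Real.exp (-ζ.re * Real.cosh t + (ν.re + 1) * t) +
      Real.exp (-ζ.re * Real.cosh t + (ν.re - 1) * t))
    (Eventually.of_forall fun ν' => aestronglyMeasurable_besselK_integrand ν' ζ) ?_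
    ((integrable_exp_neg_mul_cosh hζ _).add (integrable_exp_neg_mul_cosh hζ _))
    (Eventually.of_forall fun t => by fun_prop)
  filter_upwards [Metric.ball_mem_nhds ν one_pos] with ν' hν'
  refine Eventually.of_forall fun t => ?_
  have h1 : |ν'.re - ν.re| ≤ 1 := by
    rw [← Complex.sub_re]
    exact (Complex.abs_re_le_norm _).trans (by simpa [dist_eq_norm] using (Metric.mem_ball.1 hν').le)
  rw [abs_le] at h1
  rw [norm_besselK_integrand]
  rcases le_total 0 t with ht | ht
  · refine le_trans (Real.exp_le_exp.2 ?_) (le_add_of_nonneg_right (Real.exp_pos _).le)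
    nlinarith
  · refine le_trans (Real.exp_le_exp.2 ?_) (le_add_of_nonneg_left (Real.exp_pos _).le)
    nlinarith

/-! ### The behaviour of `besselK` at the origin -/

theorem integrable_exp_neg_exp {a : ℝ} (ha : 0 < a) :
    Integrable fun u : ℝ => Real.exp (-Real.exp u + a * u) := by
  have h := (integrableOn_image_iff_integrableOn_abs_deriv_smul (s := Set.univ)
    MeasurableSet.univ (fun x _ => (Real.hasDerivAt_exp x).hasDerivWithinAt)
    Real.exp_injective.injOn (fun x => Real.exp (-x) * x ^ (a - 1))).1 (by
      rw [Set.image_univ, Real.range_exp]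
      exact Real.GammaIntegral_convergent ha)
  rw [integrableOn_univ] at h
  convert! h using 2 with u
  rw [abs_of_pos (Real.exp_pos u), smul_eq_mul, ← Real.exp_mul, ← Real.exp_add, ← Real.exp_add]
  congr 1; ring

theorem integral_exp_neg_exp {ν : ℂ} (hν : 0 < ν.re) :
    ∫ u : ℝ, Complex.exp (-Complex.exp u + ν * u) = Complex.Gamma ν := by
  have h := integral_image_eq_integral_abs_deriv_smul (s := Set.univ)
    MeasurableSet.univ (fun x _ => (Real.hasDerivAt_exp x).hasDerivWithinAt)
    Real.exp_injective.injOn (fun x : ℝ => ((Real.exp (-x) : ℝ) : ℂ) * (x : ℂ) ^ (ν - 1))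
  rw [Set.image_univ, Real.range_exp, Measure.restrict_univ] at h
  rw [Complex.Gamma_eq_integral hν, Complex.GammaIntegral, h]
  refine integral_congr_ae (Eventually.of_forall fun u => ?_)
  have h0 : ((Real.exp u : ℝ) : ℂ) ≠ 0 := by exact_mod_cast (Real.exp_pos u).ne'
  simp only [abs_of_pos (Real.exp_pos u)]
  rw [Complex.cpow_def_of_ne_zero h0, ← Complex.ofReal_log (Real.exp_pos u).le, Real.log_exp,
    Complex.real_smul, Complex.ofReal_exp, Complex.ofReal_exp, Complex.ofReal_neg,
    Complex.ofReal_exp, ← Complex.exp_add, ← Complex.exp_add]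
  congr 1; ring

/-- The shift `t = u - (ρ - log 2)` turns the integrand into that of the Gamma integral times a
factor that tends to `1` as `ρ → -∞` and never exceeds `1`. -/
theorem exp_mul_besselK_exp (ν : ℂ) (ρ : ℝ) :
    Complex.exp (ν * (ρ - Real.log 2 : ℝ)) * besselK ν (Real.exp ρ) =
      ∫ u : ℝ, Complex.exp (-(Real.exp u + Real.exp (2 * ρ - u) / 4 : ℝ) + ν * u) := by
  rw [besselK, ← integral_sub_right_eq_self _ (ρ - Real.log 2), ← integral_const_mul]
  refine integral_congr_ae (Eventually.of_forall fun u => ?_)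
  have h2 : Real.exp ρ * Real.cosh (u - (ρ - Real.log 2)) =
      Real.exp u + Real.exp (2 * ρ - u) / 4 := by
    have e1 : Real.exp (u - (ρ - Real.log 2)) = Real.exp u * 2 / Real.exp ρ := by
      rw [show u - (ρ - Real.log 2) = u + Real.log 2 - ρ by ring, Real.exp_sub, Real.exp_add,
        Real.exp_log two_pos]
    have e2 : Real.exp (-(u - (ρ - Real.log 2))) = Real.exp ρ / (Real.exp u * 2) := by
      rw [Real.exp_neg, e1, inv_div]
    have e3 : Real.exp (2 * ρ - u) = Real.exp ρ * Real.exp ρ / Real.exp u := by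
      rw [Real.exp_sub, two_mul, Real.exp_add]
    rw [Real.cosh_eq, e1, e2, e3]
    have := Real.exp_pos ρ
    have := Real.exp_pos u
    field_simp
    ring
  dsimp only
  rw [← Complex.exp_add, ← h2]
  congr 1
  push_cast
  ring

theorem tendsto_exp_mul_besselK {ν : ℂ} (hν : 0 < ν.re) :
    Tendsto (fun ρ : ℝ => Complex.exp (ν * (ρ - Real.log 2 : ℝ)) * besselK ν (Real.exp ρ)) atBot
      (𝓝 (Complex.Gamma ν)) := by
  simp only [exp_mul_besselK_exp]
  rw [← integral_exp_neg_exp hν]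
  refine tendsto_integral_filter_of_dominated_convergence
    (fun u => Real.exp (-Real.exp u + ν.re * u)) (Eventually.of_forall fun ρ => ?_)
    (Eventually.of_forall fun ρ => Eventually.of_forall fun u => ?_)
    (integrable_exp_neg_exp hν) (Eventually.of_forall fun u => ?_)
  · exact Continuous.aestronglyMeasurable (by fun_prop)
  · rw [Complex.norm_exp, Real.exp_le_exp, Complex.add_re, Complex.re_mul_ofReal, ←
      Complex.ofReal_neg, Complex.ofReal_re]
    have := Real.exp_pos (2 * ρ - u)
    linarith
  · have h1 : Tendsto (fun ρ : ℝ => Real.exp (2 * ρ - u)) atBot (𝓝 0) :=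
      Real.tendsto_exp_atBot.comp (tendsto_atBot_add_const_right _ (-u)
        (tendsto_id.const_mul_atBot two_pos))
    have h2 : Tendsto (fun ρ : ℝ => Real.exp u + Real.exp (2 * ρ - u) / 4) atBot
        (𝓝 (Real.exp u)) := by
      simpa using (h1.div_const 4).const_add (Real.exp u)
    have h3 := ((Complex.continuous_ofReal.tendsto _).comp h2).neg.add_const (ν * u)
    rw [Complex.ofReal_exp] at h3
    exact (Complex.continuous_exp.tendsto _).comp h3

/-! ### The modified Bessel function and the connection formula -/

/-- The modified Bessel function `I_ν(z) = exp(-π i ν / 2) J_ν(i z)`, as a function of a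
logarithm of `z`. -/
noncomputable def besselI (ν w : ℂ) : ℂ :=
  Complex.exp (-(Real.pi * Complex.I / 2 * ν)) * besselJLog ν (w + Real.pi * Complex.I / 2)

theorem besselJLog_add_half_pi (ν w : ℂ) :
    besselJLog ν (w + Real.pi * Complex.I / 2) =
      Complex.exp (Real.pi * Complex.I / 2 * ν) * besselI ν w := by
  rw [besselI, ← mul_assoc, ← Complex.exp_add, add_neg_cancel, Complex.exp_zero, one_mul]

theorem besselJLog_sub_half_pi (ν w : ℂ) :
    besselJLog ν (w - Real.pi * Complex.I / 2) =
      Complex.exp (-(Real.pi * Complex.I / 2 * ν)) * besselI ν w := by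
  rw [besselI, show w + Real.pi * Complex.I / 2 =
    w - Real.pi * Complex.I / 2 + Real.pi * Complex.I by ring, besselJLog_add_pi_mul_I,
    ← mul_assoc, ← mul_assoc, ← Complex.exp_add, ← Complex.exp_add]
  ring_nf
  rw [Complex.exp_zero, one_mul]

theorem exp_half_pi_mul_I : Complex.exp (Real.pi * Complex.I / 2) = Complex.I := by
  rw [show (Real.pi * Complex.I / 2 : ℂ) = Real.pi / 2 * Complex.I by ring,
    Complex.exp_pi_div_two_mul_I]

theorem exp_half_pi_mul_add_one (ν : ℂ) : Complex.exp (Real.pi * Complex.I / 2 * (ν + 1)) =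
    Complex.exp (Real.pi * Complex.I / 2 * ν) * Complex.I := by
  rw [mul_add, mul_one, Complex.exp_add, exp_half_pi_mul_I]

theorem hasDerivAt_besselI (ν w : ℂ) :
    HasDerivAt (besselI ν) (ν * besselI ν w + Complex.exp w * besselI (ν + 1) w) w := by
  have h := ((hasDerivAt_besselJLog ν (w + Real.pi * Complex.I / 2)).comp_add_const w
    (Real.pi * Complex.I / 2)).const_mul (Complex.exp (-(Real.pi * Complex.I / 2 * ν)))
  convert! h using 1
  rw [besselJLog_add_half_pi, besselJLog_add_half_pi, exp_half_pi_mul_add_one, Complex.exp_add,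
    exp_half_pi_mul_I, Complex.exp_neg]
  have h0 := Complex.exp_ne_zero (Real.pi * Complex.I / 2 * ν)
  field_simp
  linear_combination (Complex.exp w * besselI (ν + 1) w) * Complex.I_sq

theorem besselI_recurrence (ν w : ℂ) :
    2 * ν * besselI ν w = Complex.exp w * (besselI (ν - 1) w - besselI (ν + 1) w) := by
  have h := besselJLog_recurrence ν (w + Real.pi * Complex.I / 2)
  have h1 := exp_half_pi_mul_add_one (ν - 1)
  rw [sub_add_cancel] at h1
  rw [besselJLog_add_half_pi, besselJLog_add_half_pi, besselJLog_add_half_pi,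
    exp_half_pi_mul_add_one, Complex.exp_add, exp_half_pi_mul_I, h1] at h
  refine mul_left_cancel₀ (mul_ne_zero (Complex.exp_ne_zero (Real.pi * Complex.I / 2 * (ν - 1)))
    Complex.I_ne_zero) ?_
  linear_combination h + Complex.exp w * besselI (ν + 1) w *
    Complex.exp (Real.pi * Complex.I / 2 * (ν - 1)) * Complex.I * Complex.I_sq

theorem hasDerivAt_besselI_add_one (ν w : ℂ) :
    HasDerivAt (besselI (ν + 1)) (Complex.exp w * besselI ν w - (ν + 1) * besselI (ν + 1) w) w := by
  convert! hasDerivAt_besselI (ν + 1) w using 1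
  have := besselI_recurrence (ν + 1) w
  rw [add_sub_cancel_right] at this
  linear_combination -this

/-- Only the term `k = 0` of the power series survives; dominated convergence applies for `ρ ≤ log
2`, where the remaining exponentials have modulus at most `1`. -/
theorem tendsto_exp_mul_besselI (ν : ℂ) :
    Tendsto (fun ρ : ℝ => Complex.exp (-ν * (ρ - Real.log 2 : ℝ)) * besselI ν ρ) atBot
      (𝓝 (Complex.Gamma (ν + 1))⁻¹) := by
  obtain ⟨u, hu, hb⟩ := exists_norm_besselTerm_le ‖ν‖ 0
  have hc : ∀ k, ‖besselTerm ν k (Complex.log 2)‖ ≤ u k := hb ν le_rfl _ (by simp)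
  have hterm : ∀ (ρ : ℝ) (k : ℕ), Complex.exp (-ν * (ρ - Real.log 2 : ℝ)) *
      (Complex.exp (-(Real.pi * Complex.I / 2 * ν)) *
        besselTerm ν k (ρ + Real.pi * Complex.I / 2)) =
      besselTerm ν k (Complex.log 2) *
        Complex.exp (2 * k * ((ρ - Real.log 2 : ℝ) + Real.pi * Complex.I / 2)) := by
    intro ρ k
    have h2 : Complex.log 2 = (Real.log 2 : ℝ) := by
      rw [Complex.ofReal_log zero_le_two, Complex.ofReal_ofNat]
    simp only [besselTerm, sub_self, mul_zero, Complex.exp_zero, mul_one]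
    rw [mul_left_comm (Complex.exp (-(Real.pi * Complex.I / 2 * ν))), mul_left_comm,
      ← Complex.exp_add, ← Complex.exp_add, h2]
    congr 2
    push_cast
    ring
  have hnorm : ∀ (ρ : ℝ) (k : ℕ),
      ‖Complex.exp (2 * k * ((ρ - Real.log 2 : ℝ) + Real.pi * Complex.I / 2))‖ =
        Real.exp (2 * (ρ - Real.log 2)) ^ k := by
    intro ρ k
    rw [Complex.norm_exp, ← Real.exp_nat_mul]
    congr 1
    rw [show (2 * (k : ℂ) * ((ρ - Real.log 2 : ℝ) + Real.pi * Complex.I / 2)) =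
      ((2 * k * (ρ - Real.log 2) : ℝ) : ℂ) + ((k * Real.pi : ℝ) : ℂ) * Complex.I by
        push_cast; ring]
    rw [Complex.add_re, Complex.re_ofReal_mul, Complex.I_re, Complex.ofReal_re]
    ring
  have heq : ∀ ρ : ℝ, Complex.exp (-ν * (ρ - Real.log 2 : ℝ)) * besselI ν ρ =
      ∑' k, besselTerm ν k (Complex.log 2) *
        Complex.exp (2 * k * ((ρ - Real.log 2 : ℝ) + Real.pi * Complex.I / 2)) := by
    intro ρ
    have h := ((hasSum_besselTerm ν (ρ + Real.pi * Complex.I / 2)).mul_left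
      (Complex.exp (-(Real.pi * Complex.I / 2 * ν)))).mul_left
      (Complex.exp (-ν * (ρ - Real.log 2 : ℝ)))
    simp only [hterm] at h
    exact h.tsum_eq.symm
  have hlim0 : Tendsto (fun ρ : ℝ => Real.exp (2 * (ρ - Real.log 2))) atBot (𝓝 0) :=
    Real.tendsto_exp_atBot.comp
      ((tendsto_atBot_add_const_right _ (-Real.log 2) tendsto_id).const_mul_atBot two_pos)
  have hlim : ∀ k : ℕ, Tendsto (fun ρ : ℝ => besselTerm ν k (Complex.log 2) *
      Complex.exp (2 * k * ((ρ - Real.log 2 : ℝ) + Real.pi * Complex.I / 2))) atBot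
      (𝓝 (if k = 0 then (Complex.Gamma (ν + 1))⁻¹ else 0)) := by
    intro k
    rcases eq_or_ne k 0 with rfl | hk
    · simp [besselTerm]
    · rw [if_neg hk, tendsto_zero_iff_norm_tendsto_zero]
      simp only [norm_mul, hnorm]
      simpa [hk] using (hlim0.pow k).const_mul ‖besselTerm ν k (Complex.log 2)‖
  have hle : ∀ᶠ ρ : ℝ in atBot, ρ ≤ Real.log 2 := eventually_le_atBot _
  have h := tendsto_tsum_of_dominated_convergence hu hlim (by
    filter_upwards [hle] with ρ hρ k
    rw [norm_mul, hnorm]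
    refine (mul_le_of_le_one_right (norm_nonneg _) (pow_le_one₀ (Real.exp_pos _).le ?_)).trans
      (hc k)
    rw [Real.exp_le_one_iff]
    linarith)
  simp only [← heq, tsum_ite_eq] at h
  exact h

theorem exp_re_pos {w : ℂ} (hw : |w.im| < Real.pi / 2) : 0 < (Complex.exp w).re := by
  rw [abs_lt] at hw
  rw [Complex.exp_re]
  exact mul_pos (Real.exp_pos _) (Real.cos_pos_of_mem_Ioo ⟨hw.1, hw.2⟩)

theorem hasDerivAt_besselK_exp (ν : ℂ) {w : ℂ} (hw : |w.im| < Real.pi / 2) :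
    HasDerivAt (fun w => besselK ν (Complex.exp w)) (ν * besselK ν (Complex.exp w) -
      Complex.exp w * besselK (ν + 1) (Complex.exp w)) w := by
  have h0 := Complex.exp_ne_zero w
  convert! (hasDerivAt_besselK ν (exp_re_pos hw)).comp w (Complex.hasDerivAt_exp w) using 1
  field_simp

theorem hasDerivAt_besselK_add_one_exp (ν : ℂ) {w : ℂ} (hw : |w.im| < Real.pi / 2) :
    HasDerivAt (fun w => besselK (ν + 1) (Complex.exp w)) (-Complex.exp w *
      besselK ν (Complex.exp w) - (ν + 1) * besselK (ν + 1) (Complex.exp w)) w := by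
  have h0 := Complex.exp_ne_zero w
  convert! (hasDerivAt_besselK_add_one ν (exp_re_pos hw)).comp w (Complex.hasDerivAt_exp w) using 1
  field_simp

/-- Evaluates a Wronskian: it is constant on the strip, and its value can be read off from leading
asymptotics as `Re w → -∞`. -/
theorem eq_of_hasDerivAt_zero_of_strip {f : ℂ → ℂ}
    (hf : ∀ w : ℂ, |w.im| < Real.pi / 2 → HasDerivAt f 0 w) {L : ℂ}
    (hL : Tendsto (fun ρ : ℝ => f ρ) atBot (𝓝 L)) {w : ℂ} (hw : |w.im| < Real.pi / 2) :
    f w = L := by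
  have hopen : IsOpen {w : ℂ | |w.im| < Real.pi / 2} :=
    isOpen_lt (continuous_abs.comp Complex.continuous_im) continuous_const
  have hconv : Convex ℝ {w : ℂ | |w.im| < Real.pi / 2} := by
    have : {w : ℂ | |w.im| < Real.pi / 2} =
        Complex.imLm ⁻¹' (Set.Ioo (-(Real.pi / 2)) (Real.pi / 2)) := by
      ext w; simp [abs_lt]
    rw [this]
    exact (convex_Ioo _ _).linear_preimage _
  have hc : ∀ ρ : ℝ, f ρ = f w := fun ρ =>
    hopen.is_const_of_deriv_eq_zero hconv.isPreconnected
      (fun w hw => (hf w hw).differentiableAt.differentiableWithinAt)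
      (fun w hw => (hf w hw).deriv) (by simp [Real.pi_pos]) hw
  simp only [hc] at hL
  exact tendsto_nhds_unique tendsto_const_nhds hL

theorem tendsto_exp_sub_log_two :
    Tendsto (fun ρ : ℝ => Complex.exp (2 * (ρ - Real.log 2 : ℝ))) atBot (𝓝 0) := by
  rw [tendsto_zero_iff_norm_tendsto_zero]
  have h : ∀ ρ : ℝ, ‖Complex.exp (2 * (ρ - Real.log 2 : ℝ))‖ =
      Real.exp (2 * (ρ - Real.log 2)) := by
    intro ρ
    rw [Complex.norm_exp]
    norm_cast
  simp only [h]
  exact Real.tendsto_exp_atBot.comp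
      ((tendsto_atBot_add_const_right _ (-Real.log 2) tendsto_id).const_mul_atBot two_pos)

theorem exp_eq_two_mul_exp_sub (ρ : ℝ) :
    Complex.exp ρ = 2 * Complex.exp (ρ - Real.log 2 : ℝ) := by
  rw [Complex.ofReal_sub, Complex.exp_sub, ← Complex.ofReal_exp (Real.log 2),
    Real.exp_log two_pos, Complex.ofReal_ofNat]
  ring

/-- The Wronskian of `2 K_ν` and `I_ν`. -/
theorem wronskian_besselK_besselI_of_pos {ν w : ℂ} (hν : 0 < ν.re) (hw : |w.im| < Real.pi / 2) :
    Complex.exp w * (besselK ν (Complex.exp w) * besselI (ν + 1) w +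
      besselK (ν + 1) (Complex.exp w) * besselI ν w) = 2 := by
  refine eq_of_hasDerivAt_zero_of_strip (f := fun w => Complex.exp w *
    (besselK ν (Complex.exp w) * besselI (ν + 1) w +
      besselK (ν + 1) (Complex.exp w) * besselI ν w)) (fun w hw => ?_) ?_ hw
  · convert! (Complex.hasDerivAt_exp w).mul
      (((hasDerivAt_besselK_exp ν hw).mul (hasDerivAt_besselI_add_one ν w)).add
        ((hasDerivAt_besselK_add_one_exp ν hw).mul (hasDerivAt_besselI ν w))) using 1
    simp only [Pi.mul_apply, Pi.add_apply]
    ring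
  · have hν1 : 0 < (ν + 1).re := by rw [Complex.add_re, Complex.one_re]; positivity
    have h1 := (tendsto_exp_sub_log_two.mul
      ((tendsto_exp_mul_besselK hν).mul (tendsto_exp_mul_besselI (ν + 1)))).add
      ((tendsto_exp_mul_besselK hν1).mul (tendsto_exp_mul_besselI ν))
    have h2 := h1.const_mul 2
    rw [zero_mul, zero_add, mul_inv_cancel₀ (Complex.Gamma_ne_zero_of_re_pos hν1), mul_one] at h2
    refine h2.congr fun ρ => ?_
    rw [exp_eq_two_mul_exp_sub, Complex.ofReal_exp, exp_eq_two_mul_exp_sub,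
      show 2 * ((ρ - Real.log 2 : ℝ) : ℂ) =
        (ρ - Real.log 2 : ℝ) + (ρ - Real.log 2 : ℝ) by ring, neg_mul, neg_mul, add_mul,
        one_mul, neg_add, Complex.exp_add, Complex.exp_add, Complex.exp_add, Complex.exp_neg,
        Complex.exp_neg]
    have e1 := Complex.exp_ne_zero (ρ - Real.log 2 : ℝ)
    have e2 := Complex.exp_ne_zero (ν * (ρ - Real.log 2 : ℝ))
    field_simp

/-- The asymptotics of `besselK` at the origin require `Re ν > 0`. The two recurrences show that the
Wronskian is the same for `ν` and `ν + 1`, which removes the restriction. -/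
theorem wronskian_besselK_besselI (ν : ℂ) {w : ℂ} (hw : |w.im| < Real.pi / 2) :
    Complex.exp w * (besselK ν (Complex.exp w) * besselI (ν + 1) w +
      besselK (ν + 1) (Complex.exp w) * besselI ν w) = 2 := by
  obtain ⟨n, hn⟩ := exists_nat_gt (-ν.re)
  induction n generalizing ν with
  | zero => exact wronskian_besselK_besselI_of_pos (by simpa using hn) hw
  | succ n ih =>
    have h := ih (ν + 1) (by
      rw [Complex.add_re, Complex.one_re]
      push_cast at hn
      linarith)
    have h1 := besselK_recurrence (ν + 1) (exp_re_pos hw)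
    have h2 := besselI_recurrence (ν + 1) w
    rw [add_sub_cancel_right] at h1 h2
    linear_combination h + besselI (ν + 1) w * h1 - besselK (ν + 1) (Complex.exp w) * h2

/-- The Wronskian of `I_ν` and `I_{-ν}`. -/
theorem wronskian_besselI (ν : ℂ) {w : ℂ} (hw : |w.im| < Real.pi / 2) :
    2 * ν * (besselI ν w * besselI (-ν) w) + Complex.exp w * (besselI (ν + 1) w * besselI (-ν) w -
      besselI (-ν + 1) w * besselI ν w) = 2 * (Complex.sin (Real.pi * ν) / Real.pi) := by
  refine eq_of_hasDerivAt_zero_of_strip (f := fun w => 2 * ν * (besselI ν w * besselI (-ν) w) +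
    Complex.exp w * (besselI (ν + 1) w * besselI (-ν) w - besselI (-ν + 1) w * besselI ν w))
    (fun w hw => ?_) ?_ hw
  · convert! (((hasDerivAt_besselI ν w).mul (hasDerivAt_besselI (-ν) w)).const_mul (2 * ν)).add
      ((Complex.hasDerivAt_exp w).mul
      (((hasDerivAt_besselI_add_one ν w).mul (hasDerivAt_besselI (-ν) w)).sub
        ((hasDerivAt_besselI_add_one (-ν) w).mul (hasDerivAt_besselI ν w)))) using 1
    simp only [Pi.mul_apply, Pi.sub_apply]
    ring
  · have h1 := (((tendsto_exp_mul_besselI ν).mul (tendsto_exp_mul_besselI (-ν))).const_mul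
      (2 * ν)).add (((tendsto_exp_sub_log_two.mul (((tendsto_exp_mul_besselI (ν + 1)).mul
        (tendsto_exp_mul_besselI (-ν))).sub ((tendsto_exp_mul_besselI (-ν + 1)).mul
        (tendsto_exp_mul_besselI ν))))).const_mul 2)
    have h2 : 2 * ν * ((Complex.Gamma (ν + 1))⁻¹ * (Complex.Gamma (-ν + 1))⁻¹) =
        2 * (Complex.sin (Real.pi * ν) / Real.pi) := by
      have h3 := Complex.one_div_Gamma_eq_self_mul_one_div_Gamma_add_one ν
      have h4 := Complex.Gamma_mul_Gamma_one_sub ν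
      rw [mul_assoc, ← mul_assoc ν, ← h3, ← mul_inv, show -ν + 1 = 1 - ν by ring, h4, inv_div]
    rw [h2, zero_mul, mul_zero, add_zero] at h1
    refine h1.congr fun ρ => ?_
    rw [exp_eq_two_mul_exp_sub,
      show 2 * ((ρ - Real.log 2 : ℝ) : ℂ) =
        (ρ - Real.log 2 : ℝ) + (ρ - Real.log 2 : ℝ) by ring, neg_neg, neg_add, neg_add, neg_neg,
        add_mul, add_mul, neg_mul, neg_mul, one_mul, Complex.exp_add, Complex.exp_add,
        Complex.exp_add, Complex.exp_neg, Complex.exp_neg]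
    have e1 := Complex.exp_ne_zero (ρ - Real.log 2 : ℝ)
    have e2 := Complex.exp_ne_zero (ν * (ρ - Real.log 2 : ℝ))
    field_simp

/-- Three solutions of one second order equation satisfy `y₁ W(y₂,y₃) + y₂ W(y₃,y₁) + y₃ W(y₁,y₂) =
0`. For `K_ν`, `I_ν`, `I_{-ν}` all three Wronskians are known, because `besselK` is even in the
order. -/
theorem besselI_neg_sub_besselI (ν : ℂ) {w : ℂ} (hw : |w.im| < Real.pi / 2) :
    besselI (-ν) w - besselI ν w =
      Complex.sin (Real.pi * ν) / Real.pi * besselK ν (Complex.exp w) := by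
  have h1 := wronskian_besselK_besselI ν hw
  have h2 := wronskian_besselK_besselI (-ν) hw
  have h3 := wronskian_besselI ν hw
  have h4 := besselK_recurrence ν (exp_re_pos hw)
  rw [besselK_neg, ← besselK_neg (-ν + 1), show -(-ν + 1) = ν - 1 by ring] at h2
  refine mul_left_cancel₀ (two_ne_zero (α := ℂ)) ?_
  linear_combination besselK ν (Complex.exp w) * h3 - besselI (-ν) w * h1 + besselI ν w * h2 -
    besselI ν w * besselI (-ν) w * h4

/-- Connection formula for the Hankel function of the first kind. -/
theorem besselJLog_neg_sub_add_half_pi (ν : ℂ) {w : ℂ} (hw : |w.im| < Real.pi / 2) :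
    besselJLog (-ν) (w + Real.pi * Complex.I / 2) - Complex.exp (-(Real.pi * Complex.I * ν)) *
      besselJLog ν (w + Real.pi * Complex.I / 2) =
    Complex.exp (-(Real.pi * Complex.I / 2 * ν)) * (Complex.sin (Real.pi * ν) / Real.pi *
      besselK ν (Complex.exp w)) := by
  rw [← besselI_neg_sub_besselI ν hw, besselJLog_add_half_pi, besselJLog_add_half_pi, ← mul_assoc,
    ← Complex.exp_add, mul_sub]
  ring_nf

/-- Connection formula for the Hankel function of the second kind. -/
theorem besselJLog_neg_sub_sub_half_pi (ν : ℂ) {w : ℂ} (hw : |w.im| < Real.pi / 2) :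
    Complex.exp (-(Real.pi * Complex.I * ν)) * besselJLog (-ν) (w - Real.pi * Complex.I / 2) -
      besselJLog ν (w - Real.pi * Complex.I / 2) =
    Complex.exp (-(Real.pi * Complex.I / 2 * ν)) * (Complex.sin (Real.pi * ν) / Real.pi *
      besselK ν (Complex.exp w)) := by
  rw [← besselI_neg_sub_besselI ν hw, besselJLog_sub_half_pi, besselJLog_sub_half_pi, ← mul_assoc,
    ← Complex.exp_add, mul_sub]
  ring_nf

/-! ### The Bessel function in terms of decaying functions -/

/-- The combination of products of Hankel and Bessel functions that is proportional to
`besselAtRoot` at `s = z / (4π)` in the upper half plane. -/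
noncomputable def besselHankel (μ : ℂ) (m : ℤ) (z : ℂ) : ℂ :=
  Complex.exp (-(Real.pi * Complex.I / 2 * (2 * μ + m / 2))) *
      besselK (2 * μ + m / 2) (-Complex.I * z) *
      besselJLog (-(2 * μ - m / 2)) (starRingEnd ℂ (Complex.log z)) +
    Complex.exp (-(Real.pi * Complex.I / 2 * (2 * μ - m / 2))) *
      besselJLog (2 * μ + m / 2) (Complex.log z) *
      besselK (2 * μ - m / 2) (Complex.I * starRingEnd ℂ z)

theorem neg_I_mul_re (z : ℂ) : (-Complex.I * z).re = z.im := by simp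

theorem I_mul_conj_re (z : ℂ) : (Complex.I * starRingEnd ℂ z).re = z.im := by simp

theorem four_pi_mul_im (s : ℂ) : (4 * Real.pi * s : ℂ).im = 4 * Real.pi * s.im := by
  rw [show (4 * Real.pi * s : ℂ) = ((4 * Real.pi : ℝ) : ℂ) * s by push_cast; ring,
    Complex.im_ofReal_mul]

theorem abs_arg_sub_lt {z : ℂ} (hz : 0 < z.im) : |z.arg - Real.pi / 2| < Real.pi / 2 := by
  have h0 : z ≠ 0 := by rintro rfl; simp at hz
  have h1 : 0 < Real.sin z.arg := by
    rw [Complex.sin_arg]; exact div_pos hz (norm_pos_iff.2 h0)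
  have h2 : 0 < z.arg := by
    by_contra! h
    exact h1.not_ge (Real.sin_nonpos_of_nonpos_of_neg_pi_le h (Complex.neg_pi_lt_arg z).le)
  have h3 : z.arg ≠ Real.pi := by
    intro h
    rw [h, Real.sin_pi] at h1
    exact h1.false
  have h4 := lt_of_le_of_ne (Complex.arg_le_pi z) h3
  rw [abs_lt]
  constructor <;> linarith

/-- With `α = 2μ + m/2` and `β = 2μ - m/2`, substitute the first connection formula for `J_{-α}(z)`
and the second for `J_β(z̄)`. The terms `J_α(z) J_{-β}(z̄)` cancel by `he`, and by `h1`, `h2` both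
remaining terms carry the factor `S`. The sign `ε` allows both parities of `m` to be treated at
once. -/
theorem besselPair_sub_eq_besselHankel {μ σ ε S : ℂ} {m : ℤ} {z : ℂ} (hz : 0 < z.im)
    (h1 : Complex.sin (Real.pi * (2 * μ + m / 2)) = σ * S)
    (h2 : Complex.sin (Real.pi * (2 * μ - m / 2)) = ε * σ * S) (hε : ε * ε = 1)
    (he : Complex.exp (-(Real.pi * Complex.I * (2 * μ + m / 2))) =
      ε * Complex.exp (-(Real.pi * Complex.I * (2 * μ - m / 2)))) :
    besselJPair μ m z - ε * besselJPair (-μ) (-m) z =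
      S * (σ / Real.pi * besselHankel μ m z) := by
  have h0 : z ≠ 0 := by rintro rfl; simp at hz
  have harg := abs_arg_sub_lt hz
  -- For `z` in the upper half plane, quarter turns bring `log z` and its conjugate into the strip
  -- where the connection formulas hold.
  have hw1 : |(Complex.log z - Real.pi * Complex.I / 2).im| < Real.pi / 2 := by
    simpa [Complex.log_im] using harg
  have hw2 : |(starRingEnd ℂ (Complex.log z) + Real.pi * Complex.I / 2).im| < Real.pi / 2 := by
    rw [← abs_neg]
    simpa [Complex.log_im, neg_add_eq_sub] using harg
  have hexp1 : Complex.exp (Complex.log z - Real.pi * Complex.I / 2) = -Complex.I * z := by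
    rw [Complex.exp_sub, Complex.exp_log h0, exp_half_pi_mul_I, Complex.div_I]; ring
  have hexp2 : Complex.exp (starRingEnd ℂ (Complex.log z) + Real.pi * Complex.I / 2) =
      Complex.I * starRingEnd ℂ z := by
    rw [Complex.exp_add, Complex.exp_conj, Complex.exp_log h0, exp_half_pi_mul_I, mul_comm]
  have k1 := besselJLog_neg_sub_add_half_pi (2 * μ + m / 2) hw1
  have k2 := besselJLog_neg_sub_sub_half_pi (2 * μ - m / 2) hw2
  rw [hexp1, sub_add_cancel, h1, he] at k1
  rw [hexp2, add_sub_cancel_right, h2] at k2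
  simp only [besselJPair, besselHankel]
  push_cast
  rw [show -2 * μ - (m : ℂ) / 2 = -(2 * μ + m / 2) by ring,
    show -2 * μ + (m : ℂ) / 2 = -(2 * μ - m / 2) by ring,
    show -2 * -μ - -(m : ℂ) / 2 = 2 * μ + m / 2 by ring,
    show -2 * -μ + -(m : ℂ) / 2 = 2 * μ - m / 2 by ring]
  linear_combination
    besselJLog (-(2 * μ - m / 2)) (starRingEnd ℂ (Complex.log z)) * k1 +
    ε * besselJLog (2 * μ + m / 2) (Complex.log z) * k2 +
    (Complex.exp (-(Real.pi * Complex.I / 2 * (2 * μ - m / 2))) *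
      besselJLog (2 * μ + m / 2) (Complex.log z) *
      besselK (2 * μ - m / 2) (Complex.I * starRingEnd ℂ z)) * (σ * S / Real.pi) * hε

/-- The constant does not depend on `μ`, so the right side extends continuously through the
exceptional parameters. The sign `(-1)^k` in it comes from shifting the sine by `kπ`, where `m = 2k`
or `m = 2k + 1`. -/
theorem exists_besselGeneric_eq (m : ℤ) : ∃ c : ℂ, ∀ μ s : ℂ, 0 < s.im →
    (¬∃ k : ℤ, 4 * μ = 2 * k + m) →
      besselGeneric μ m s = c * besselHankel μ m (4 * Real.pi * s) := by
  have hpi : (Real.pi : ℂ) ≠ 0 := Complex.ofReal_ne_zero.2 Real.pi_ne_zero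
  have him : ∀ s : ℂ, 0 < s.im → 0 < (4 * Real.pi * s : ℂ).im := by
    intro s hs
    rw [four_pi_mul_im]
    have := Real.pi_pos
    positivity
  rcases Int.even_or_odd' m with ⟨k, rfl | rfl⟩
  · refine ⟨2 * Real.pi ^ 2 * (((k.negOnePow : ℤ) : ℂ) / Real.pi), fun μ s hs hμ => ?_⟩
    have hS : Complex.sin (2 * Real.pi * μ) ≠ 0 := by
      intro h
      obtain ⟨j, hj⟩ := Complex.sin_eq_zero_iff.1 h
      refine hμ ⟨j - k, ?_⟩
      have h2 : 2 * μ = j := mul_right_cancel₀ hpi (by rw [← hj]; ring)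
      push_cast
      linear_combination 2 * h2
    have h := besselPair_sub_eq_besselHankel (μ := μ) (σ := ((k.negOnePow : ℤ) : ℂ)) (ε := 1)
      (S := Complex.sin (2 * Real.pi * μ)) (m := 2 * k) (him s hs) ?_ ?_ (one_mul 1) ?_
    · rw [besselGeneric, if_pos (even_two_mul k), ← one_mul (besselJPair (-μ) _ _), h]
      field_simp
    · rw [← Complex.sin_antiperiodic.add_int_mul_eq]
      congr 1
      push_cast; ring
    · rw [one_mul, ← Complex.sin_antiperiodic.sub_int_mul_eq]
      congr 1
      push_cast; ring
    · rw [one_mul, ← Complex.exp_periodic.int_mul k (-(Real.pi * Complex.I * _))]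
      congr 1
      push_cast; ring
  · refine ⟨2 * Real.pi ^ 2 * Complex.I * (((k.negOnePow : ℤ) : ℂ) / Real.pi), fun μ s hs hμ => ?_⟩
    have hS : Complex.cos (2 * Real.pi * μ) ≠ 0 := by
      intro h
      obtain ⟨j, hj⟩ := Complex.cos_eq_zero_iff.1 h
      refine hμ ⟨j - k, ?_⟩
      have h2 : 4 * μ = 2 * j + 1 := mul_right_cancel₀ hpi (by linear_combination 2 * hj)
      push_cast
      linear_combination h2
    have h := besselPair_sub_eq_besselHankel (μ := μ) (σ := ((k.negOnePow : ℤ) : ℂ)) (ε := -1)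
      (S := Complex.cos (2 * Real.pi * μ)) (m := 2 * k + 1) (him s hs) ?_ ?_ (by norm_num) ?_
    · rw [neg_one_mul, sub_neg_eq_add] at h
      rw [besselGeneric, if_neg (Int.not_even_iff_odd.2 (odd_two_mul_add_one k)), h]
      field_simp
    · rw [← Complex.sin_add_pi_div_two, ← Complex.sin_antiperiodic.add_int_mul_eq]
      congr 1
      push_cast; ring
    · rw [mul_assoc, neg_one_mul, ← mul_neg, ← Complex.sin_sub_pi_div_two,
        ← Complex.sin_antiperiodic.sub_int_mul_eq]
      congr 1
      push_cast; ring
    · rw [neg_one_mul, ← Complex.exp_antiperiodic.sub_eq,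
        ← Complex.exp_periodic.int_mul k (-(Real.pi * Complex.I * _))]
      congr 1
      push_cast; ring

theorem continuous_besselHankel_order (m : ℤ) {z : ℂ} (hz : 0 < z.im) :
    Continuous fun μ => besselHankel μ m z := by
  have h1 : Continuous fun μ : ℂ => besselK (2 * μ + m / 2) (-Complex.I * z) :=
    (continuous_besselK_order (by rwa [neg_I_mul_re])).comp (by fun_prop)
  have h2 : Continuous fun μ : ℂ => besselK (2 * μ - m / 2) (Complex.I * starRingEnd ℂ z) :=
    (continuous_besselK_order (by rwa [I_mul_conj_re])).comp (by fun_prop)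
  have h3 : Continuous fun μ : ℂ =>
      besselJLog (-(2 * μ - m / 2)) (starRingEnd ℂ (Complex.log z)) :=
    (differentiable_besselJLog_order _).continuous.comp (by fun_prop)
  have h4 : Continuous fun μ : ℂ => besselJLog (2 * μ + m / 2) (Complex.log z) :=
    (differentiable_besselJLog_order _).continuous.comp (by fun_prop)
  simp only [besselHankel]
  fun_prop

theorem exists_besselAtRoot_eq (m : ℤ) : ∃ c : ℂ, ∀ μ s : ℂ, 0 < s.im →
    besselAtRoot μ m s = c * besselHankel μ m (4 * Real.pi * s) := by
  obtain ⟨c, hc⟩ := exists_besselGeneric_eq m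
  refine ⟨c, fun μ s hs => ?_⟩
  rw [besselAtRoot]
  split_ifs with hμ
  · refine Tendsto.limUnder_eq ?_
    have him : 0 < (4 * Real.pi * s : ℂ).im := by
      rw [four_pi_mul_im]
      have := Real.pi_pos
      positivity
    have h1 : Tendsto (fun μ' => c * besselHankel μ' m (4 * Real.pi * s)) (𝓝[≠] μ)
        (𝓝 (c * besselHankel μ m (4 * Real.pi * s))) :=
      (((continuous_besselHankel_order m him).const_mul c).tendsto μ).mono_left
        nhdsWithin_le_nhds
    refine h1.congr' ?_
    obtain ⟨k, hk⟩ := hμ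
    -- Exceptional parameters differ by multiples of `1/2`, so the punctured disc of radius `1/2`
    -- about one of them contains no other.
    filter_upwards [self_mem_nhdsWithin,
      mem_nhdsWithin_of_mem_nhds (Metric.ball_mem_nhds μ (by norm_num : (0 : ℝ) < 1 / 2))]
      with μ' hne hball
    refine (hc μ' s hs ?_).symm
    rintro ⟨k', hk'⟩
    have h2 : μ' - μ = ((k' - k : ℤ) : ℂ) / 2 := by
      push_cast; linear_combination (hk' - hk) / 4
    rw [Metric.mem_ball, dist_eq_norm, h2, norm_div, Complex.norm_intCast, Complex.norm_ofNat]
      at hball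
    have h3 : |((k' - k : ℤ) : ℝ)| < 1 := by linarith
    have h4 : k' - k = 0 := Int.abs_lt_one_iff.1 (by exact_mod_cast h3)
    rw [h4, Int.cast_zero, zero_div, sub_eq_zero] at h2
    exact hne h2
  · exact hc μ s hs hμ

/-- Conjugating `s` interchanges the two factors of `besselJPair`, that is, `m` and `-m`. Off the
real axis the principal logarithm commutes with conjugation. -/
theorem besselGeneric_conj (μ : ℂ) (m : ℤ) {s : ℂ} (hs : s.im ≠ 0) :
    besselGeneric μ m (starRingEnd ℂ s) = besselGeneric μ (-m) s := by
  have hpair : ∀ (μ : ℂ) (m : ℤ), besselJPair μ m (4 * Real.pi * starRingEnd ℂ s) =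
      besselJPair μ (-m) (4 * Real.pi * s) := by
    intro μ m
    have him : (4 * Real.pi * s : ℂ).im ≠ 0 := by
      rw [four_pi_mul_im]
      have := Real.pi_ne_zero
      positivity
    have harg : (4 * Real.pi * s : ℂ).arg ≠ Real.pi := fun h =>
      him (Complex.arg_eq_pi_iff.1 h).2
    have h1 : (4 * Real.pi * starRingEnd ℂ s : ℂ) = starRingEnd ℂ (4 * Real.pi * s) := by
      rw [map_mul, map_mul, Complex.conj_ofReal, Complex.conj_ofNat]
    rw [besselJPair, besselJPair, h1, Complex.log_conj _ harg, Complex.conj_conj, mul_comm]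
    push_cast
    rw [neg_div, sub_neg_eq_add, ← sub_eq_add_neg]
  simp only [besselGeneric, hpair, even_neg, neg_neg]

theorem besselAtRoot_conj (μ : ℂ) (m : ℤ) {s : ℂ} (hs : s.im ≠ 0) :
    besselAtRoot μ m (starRingEnd ℂ s) = besselAtRoot μ (-m) s := by
  have h : (∃ k : ℤ, 4 * μ = 2 * k + m) ↔ ∃ k : ℤ, 4 * μ = 2 * k + ((-m : ℤ) : ℂ) := by
    constructor
    · rintro ⟨k, hk⟩
      exact ⟨k + m, by push_cast; linear_combination hk⟩
    · rintro ⟨k, hk⟩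
      exact ⟨k - m, by push_cast at hk ⊢; linear_combination hk⟩
  by_cases h1 : ∃ k : ℤ, 4 * μ = 2 * k + m
  · rw [besselAtRoot, besselAtRoot, if_pos h1, if_pos (h.1 h1)]
    simp only [besselGeneric_conj _ _ hs]
  · rw [besselAtRoot, besselAtRoot, if_neg h1, if_neg (fun h2 => h1 (h.2 h2)),
      besselGeneric_conj _ _ hs]

/-! ### Bounds for the Bessel functions -/

/-- The antisymmetric part `f ↦ z g`, `g ↦ -z f` contributes only `-2 Im z · Im(f̄ g)`, so for real
`z` it preserves the energy. The damping `-1/2` is what yields the decay `|z|^(-1/2)` of `J_ν`. -/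
theorem inner_bessel_system_le (f g z q : ℂ) :
    inner ℝ f (z * g - f / 2) + inner ℝ g ((q - z) * f - g / 2) ≤
      (-1 / 2 + |z.im| + ‖q‖ / 2) * (‖f‖ ^ 2 + ‖g‖ ^ 2) := by
  have h1 : inner ℝ f (z * g - f / 2) + inner ℝ g ((q - z) * f - g / 2) =
      inner ℝ g (q * f) - (‖f‖ ^ 2 + ‖g‖ ^ 2) / 2 -
        2 * z.im * (f.re * g.im - f.im * g.re) := by
    rw [show f / 2 = ((1 / 2 : ℝ) : ℂ) * f by push_cast; ring,
      show g / 2 = ((1 / 2 : ℝ) : ℂ) * g by push_cast; ring]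
    simp only [Complex.inner, Complex.sq_norm, Complex.normSq_apply, Complex.mul_re,
      Complex.sub_re, Complex.sub_im, Complex.mul_im, Complex.conj_re, Complex.conj_im,
      Complex.ofReal_re, Complex.ofReal_im]
    ring
  have h2 : inner ℝ g (q * f) ≤ ‖q‖ / 2 * (‖f‖ ^ 2 + ‖g‖ ^ 2) := by
    refine (real_inner_le_norm _ _).trans ?_
    rw [norm_mul]
    nlinarith [mul_nonneg (norm_nonneg q) (sq_nonneg (‖f‖ - ‖g‖))]
  have h3 : |2 * (f.re * g.im - f.im * g.re)| ≤ ‖f‖ ^ 2 + ‖g‖ ^ 2 := by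
    simp only [Complex.sq_norm, Complex.normSq_apply]
    rw [abs_le]
    constructor
    · nlinarith [sq_nonneg (f.re + g.im), sq_nonneg (f.im - g.re)]
    · nlinarith [sq_nonneg (f.re - g.im), sq_nonneg (f.im + g.re)]
  have h4 : -(2 * z.im * (f.re * g.im - f.im * g.re)) ≤ |z.im| * (‖f‖ ^ 2 + ‖g‖ ^ 2) := by
    calc _ ≤ |2 * z.im * (f.re * g.im - f.im * g.re)| := neg_le_abs _
      _ = |z.im| * |2 * (f.re * g.im - f.im * g.re)| := by
        rw [← abs_mul]; congr 1; ring
      _ ≤ _ := mul_le_mul_of_nonneg_left h3 (abs_nonneg _)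
  rw [h1]
  linarith

/-- The companion of `J_ν` in the first order system `f' = z g - f / 2`,
`g' = ((ν² - 1/4) / z - z) f - g / 2` for the derivatives with respect to `log z`. -/
noncomputable def besselJCompanion (ν w : ℂ) : ℂ :=
  (ν + 1 / 2) * Complex.exp (-w) * besselJLog ν w - besselJLog (ν + 1) w

theorem hasDerivAt_besselJLog_companion (ν w : ℂ) : HasDerivAt (besselJLog ν)
    (Complex.exp w * besselJCompanion ν w - besselJLog ν w / 2) w := by
  convert! hasDerivAt_besselJLog ν w using 1
  rw [besselJCompanion, Complex.exp_neg]
  have := Complex.exp_ne_zero w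
  field_simp
  ring

theorem hasDerivAt_besselJCompanion (ν w : ℂ) : HasDerivAt (besselJCompanion ν)
    (((ν ^ 2 - 1 / 4) * Complex.exp (-w) - Complex.exp w) * besselJLog ν w -
      besselJCompanion ν w / 2) w := by
  have he : HasDerivAt (fun w : ℂ => Complex.exp (-w)) (-Complex.exp (-w)) w := by
    simpa using (hasDerivAt_neg w).cexp
  convert! ((he.const_mul (ν + 1 / 2)).mul (hasDerivAt_besselJLog ν w)).sub
    (hasDerivAt_besselJLog (ν + 1) w) using 1
  have h := besselJLog_recurrence (ν + 1) w
  rw [add_sub_cancel_right] at h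
  rw [besselJCompanion]
  have h0 := Complex.exp_ne_zero w
  rw [Complex.exp_neg]
  field_simp
  linear_combination (16 * Complex.exp w) * h

theorem continuous_besselJLog (ν : ℂ) : Continuous (besselJLog ν) :=
  continuous_iff_continuousAt.2 fun w => (hasDerivAt_besselJLog ν w).continuousAt

theorem continuous_besselJCompanion (ν : ℂ) : Continuous (besselJCompanion ν) :=
  continuous_iff_continuousAt.2 fun w => (hasDerivAt_besselJCompanion ν w).continuousAt

/-- Along the ray of argument `θ`, the exponential is the integrating factor for twice the rate in
`inner_bessel_system_le`, with `|Im z| = e^ρ |sin θ|` and `‖q‖ = ‖ν² - 1/4‖ e^(-ρ)`. -/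
theorem antitone_bessel_energy (ν : ℂ) (θ : ℝ) :
    Antitone fun ρ : ℝ => (‖besselJLog ν (ρ + θ * Complex.I)‖ ^ 2 +
      ‖besselJCompanion ν (ρ + θ * Complex.I)‖ ^ 2) *
        Real.exp (ρ - 2 * (Real.exp ρ * |Real.sin θ|) + ‖ν ^ 2 - 1 / 4‖ * Real.exp (-ρ)) := by
  have hf : ∀ ρ : ℝ, HasDerivAt (fun ρ : ℝ => besselJLog ν (ρ + θ * Complex.I)) _ ρ := fun ρ =>
    ((hasDerivAt_besselJLog_companion ν (ρ + θ * Complex.I)).comp_add_const (ρ : ℂ)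
      (θ * Complex.I)).comp_ofReal
  have hg : ∀ ρ : ℝ, HasDerivAt (fun ρ : ℝ => besselJCompanion ν (ρ + θ * Complex.I)) _ ρ :=
    fun ρ => ((hasDerivAt_besselJCompanion ν (ρ + θ * Complex.I)).comp_add_const (ρ : ℂ)
      (θ * Complex.I)).comp_ofReal
  have hQ : ∀ ρ : ℝ, HasDerivAt (fun ρ : ℝ => Real.exp (ρ - 2 * (Real.exp ρ * |Real.sin θ|) +
      ‖ν ^ 2 - 1 / 4‖ * Real.exp (-ρ))) _ ρ := fun ρ =>
    (((hasDerivAt_id ρ).sub (((Real.hasDerivAt_exp ρ).mul_const |Real.sin θ|).const_mul 2)).add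
      (((hasDerivAt_neg ρ).exp).const_mul ‖ν ^ 2 - 1 / 4‖)).exp
  have hN := fun ρ : ℝ => ((hf ρ).norm_sq.add (hg ρ).norm_sq).mul (hQ ρ)
  refine antitone_of_deriv_nonpos (fun ρ => (hN ρ).differentiableAt) fun ρ => ?_
  refine le_of_eq_of_le (hN ρ).deriv ?_
  have him : |(Complex.exp (ρ + θ * Complex.I)).im| = Real.exp ρ * |Real.sin θ| := by
    rw [Complex.exp_im]
    simp [abs_mul]
  have hq : ‖(ν ^ 2 - 1 / 4) * Complex.exp (-(ρ + θ * Complex.I))‖ =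
      ‖ν ^ 2 - 1 / 4‖ * Real.exp (-ρ) := by
    rw [norm_mul, Complex.norm_exp]
    simp
  have h := inner_bessel_system_le (besselJLog ν (ρ + θ * Complex.I))
    (besselJCompanion ν (ρ + θ * Complex.I)) (Complex.exp (ρ + θ * Complex.I))
    ((ν ^ 2 - 1 / 4) * Complex.exp (-(ρ + θ * Complex.I)))
  rw [him, hq] at h
  simp only [Pi.add_apply, Pi.sub_apply, id]
  set e := Real.exp (ρ - 2 * (Real.exp ρ * |Real.sin θ|) + ‖ν ^ 2 - 1 / 4‖ * Real.exp (-ρ))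
  have he : 0 < e := Real.exp_pos _
  nlinarith [mul_le_mul_of_nonneg_right h he.le]

theorem exists_norm_besselJLog_le (ν : ℂ) (r : ℝ) : ∃ C : ℝ, 0 ≤ C ∧ ∀ w : ℂ, r ≤ w.re →
    |w.im| ≤ Real.pi →
      ‖besselJLog ν w‖ ≤ C * Real.exp (-w.re / 2) * Real.exp |(Complex.exp w).im| := by
  obtain ⟨M, hM⟩ := (isCompact_Icc (a := -Real.pi) (b := Real.pi)).exists_bound_of_continuousOn
    (f := fun θ : ℝ => ‖besselJLog ν (r + θ * Complex.I)‖ ^ 2 +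
      ‖besselJCompanion ν (r + θ * Complex.I)‖ ^ 2) (by
    have h1 := continuous_besselJLog ν
    have h2 := continuous_besselJCompanion ν
    exact Continuous.continuousOn (by fun_prop))
  have hM0 : 0 ≤ M := (norm_nonneg _).trans (hM 0 (by simp [Real.pi_pos.le]))
  -- A bound for the weighted energy at radius `e^r`, uniform in the angle: the term with `sin θ` in
  -- the exponent is nonpositive and is dropped.
  set A := M * Real.exp (r + ‖ν ^ 2 - 1 / 4‖ * Real.exp (-r)) with hA
  have hA0 : 0 ≤ A := by positivity
  refine ⟨√A, Real.sqrt_nonneg _, fun w hr hi => ?_⟩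
  have hw : (w.re + w.im * Complex.I : ℂ) = w := Complex.re_add_im w
  have h1 := antitone_bessel_energy ν w.im hr
  simp only [hw] at h1
  have h2 := hM w.im (abs_le.1 hi)
  rw [Real.norm_of_nonneg (by positivity)] at h2
  have him : |(Complex.exp w).im| = Real.exp w.re * |Real.sin w.im| := by
    rw [Complex.exp_im, abs_mul, abs_of_pos (Real.exp_pos _)]
  rw [← him] at h1
  have h3 : (‖besselJLog ν (r + w.im * Complex.I)‖ ^ 2 +
      ‖besselJCompanion ν (r + w.im * Complex.I)‖ ^ 2) *
        Real.exp (r - 2 * (Real.exp r * |Real.sin w.im|) + ‖ν ^ 2 - 1 / 4‖ * Real.exp (-r)) ≤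
      A := by
    refine mul_le_mul h2 (Real.exp_le_exp.2 ?_) (Real.exp_pos _).le hM0
    have : 0 ≤ Real.exp r * |Real.sin w.im| := by positivity
    linarith
  have h4 : ‖besselJLog ν w‖ ^ 2 * Real.exp (w.re - 2 * |(Complex.exp w).im|) ≤ A := by
    refine le_trans ?_ (h1.trans h3)
    refine mul_le_mul (le_add_of_nonneg_right (sq_nonneg _)) (Real.exp_le_exp.2 ?_)
      (Real.exp_pos _).le (by positivity)
    have : 0 ≤ ‖ν ^ 2 - 1 / 4‖ * Real.exp (-w.re) := by positivity
    linarith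
  have h5 : ‖besselJLog ν w‖ ^ 2 ≤
      (√A * Real.exp (-w.re / 2) * Real.exp |(Complex.exp w).im|) ^ 2 := by
    rw [mul_pow, mul_pow, Real.sq_sqrt hA0, ← Real.exp_nat_mul, ← Real.exp_nat_mul, mul_assoc,
      ← Real.exp_add]
    rw [← le_div_iff₀ (Real.exp_pos _), div_eq_mul_inv, ← Real.exp_neg] at h4
    convert! h4 using 3
    push_cast
    ring
  exact (sq_le_sq₀ (norm_nonneg _) (by positivity)).1 h5

/-- From `(Re ζ - 1)(cosh t - 1) ≥ 0` the factor `exp(1 - Re ζ)` can be pulled out of the integral.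
-/
theorem exists_norm_besselK_le_of_one_le (ν : ℂ) : ∃ C : ℝ, 0 ≤ C ∧ ∀ ζ : ℂ, 1 ≤ ζ.re →
    ‖besselK ν ζ‖ ≤ C * Real.exp (-ζ.re) := by
  refine ⟨Real.exp 1 * ∫ t : ℝ, Real.exp (-1 * Real.cosh t + ν.re * t),
    mul_nonneg (Real.exp_pos _).le (integral_nonneg fun t => (Real.exp_pos _).le), fun ζ hζ => ?_⟩
  rw [mul_right_comm, ← integral_const_mul]
  refine norm_integral_le_of_norm_le ((integrable_exp_neg_mul_cosh one_pos _).const_mul _)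
    (Eventually.of_forall fun t => ?_)
  rw [norm_besselK_integrand, ← Real.exp_add, ← Real.exp_add, Real.exp_le_exp]
  nlinarith [Real.one_le_cosh t]

/-- Taking absolute values in the integral loses uniformity as `Re ζ → 0`. Instead, for `Re ζ < 1`,
the linear system for `(K_ν, K_{ν+1})` is followed horizontally from the line `Re = 1` to `ζ`, a
path of length at most `1`, with Grönwall's inequality. -/
theorem exists_norm_besselK_le (ν : ℂ) {ε : ℝ} (hε : 0 < ε) : ∃ C : ℝ, 0 ≤ C ∧ ∀ ζ : ℂ,
    0 < ζ.re → ε ≤ ‖ζ‖ → ‖besselK ν ζ‖ ≤ C * Real.exp (-ζ.re) := by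
  obtain ⟨A, hA0, hA⟩ := exists_norm_besselK_le_of_one_le ν
  obtain ⟨B, hB0, hB⟩ := exists_norm_besselK_le_of_one_le (ν + 1)
  set L := 1 + (‖ν‖ + 1) / ε with hL
  have hL0 : 0 ≤ L := by positivity
  refine ⟨A + (A + B) * Real.exp L, by positivity, fun ζ hζ hn => ?_⟩
  rcases le_total 1 ζ.re with h1 | h1
  · refine (hA ζ h1).trans (mul_le_mul_of_nonneg_right ?_ (Real.exp_pos _).le)
    exact le_add_of_nonneg_right (by positivity)
  set p : ℝ → ℂ := fun τ => (1 - τ : ℝ) + ζ.im * Complex.I with hp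
  have hpre : ∀ τ, (p τ).re = 1 - τ := fun τ => by simp [hp]
  have hpim : ∀ τ, (p τ).im = ζ.im := fun τ => by simp [hp]
  have hpd : ∀ τ, HasDerivAt p (-1) τ := by
    intro τ
    have h2 : HasDerivAt (fun τ : ℝ => 1 - τ) (-1) τ := by
      simpa using (hasDerivAt_id τ).const_sub 1
    convert! h2.ofReal_comp.add_const (ζ.im * Complex.I) using 1
    simp
  have hppos : ∀ τ ∈ Set.Icc 0 (1 - ζ.re), 0 < (p τ).re := fun τ hτ => by
    rw [hpre]; linarith [hτ.2]
  -- The path stays to the right of `ζ` at the same height, so it is no closer to the origin; this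
  -- bounds the coefficients of the system by `L`.
  have hpn : ∀ τ ∈ Set.Icc 0 (1 - ζ.re), ε ≤ ‖p τ‖ := by
    intro τ hτ
    refine hn.trans ?_
    rw [← sq_le_sq₀ (norm_nonneg _) (norm_nonneg _), Complex.sq_norm, Complex.sq_norm,
      Complex.normSq_apply, Complex.normSq_apply, hpre, hpim]
    nlinarith [hτ.2]
  have hV : ∀ τ ∈ Set.Icc 0 (1 - ζ.re),
      HasDerivAt (fun τ => (besselK ν (p τ), besselK (ν + 1) (p τ)))
      (-(ν / p τ * besselK ν (p τ) - besselK (ν + 1) (p τ)),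
        -(-besselK ν (p τ) - (ν + 1) / p τ * besselK (ν + 1) (p τ))) τ := by
    intro τ hτ
    refine HasDerivAt.prodMk ?_ ?_
    · rw [← mul_neg_one]
      exact (hasDerivAt_besselK ν (hppos τ hτ)).comp τ (hpd τ)
    · rw [← mul_neg_one]
      exact (hasDerivAt_besselK_add_one ν (hppos τ hτ)).comp τ (hpd τ)
  have hdiv : ∀ τ ∈ Set.Icc 0 (1 - ζ.re), ∀ a b : ℂ, ‖a‖ ≤ ‖ν‖ + 1 →
      ‖a / p τ * b‖ ≤ (‖ν‖ + 1) / ε * ‖b‖ := by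
    intro τ hτ a b ha
    rw [norm_mul, norm_div]
    exact mul_le_mul_of_nonneg_right (div_le_div₀ (by positivity) ha hε (hpn τ hτ))
      (norm_nonneg _)
  have hgron := norm_le_gronwallBound_of_norm_deriv_right_le (δ := A + B) (K := L) (ε := 0)
    (fun τ hτ => (hV τ hτ).continuousAt.continuousWithinAt)
    (fun τ hτ => (hV τ (Set.Ico_subset_Icc_self hτ)).hasDerivWithinAt) ?_ ?_ (1 - ζ.re)
    (Set.right_mem_Icc.2 (by linarith))
  · have hpe : p (1 - ζ.re) = ζ := by
      simp [hp]
    rw [hpe, gronwallBound_ε0, sub_zero] at hgron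
    have h2 : Real.exp (L * (1 - ζ.re)) ≤ Real.exp L * Real.exp (-ζ.re) := by
      rw [← Real.exp_add, Real.exp_le_exp]
      have h3 : 1 ≤ L := by rw [hL]; exact le_add_of_nonneg_right (by positivity)
      nlinarith
    calc ‖besselK ν ζ‖ ≤ (A + B) * Real.exp (L * (1 - ζ.re)) := (norm_fst_le _).trans hgron
      _ ≤ (A + B) * (Real.exp L * Real.exp (-ζ.re)) := by gcongr
      _ = (A + B) * Real.exp L * Real.exp (-ζ.re) := by ring
      _ ≤ _ := mul_le_mul_of_nonneg_right (le_add_of_nonneg_left hA0) (Real.exp_pos _).le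
  · have h2 : (p 0).re = 1 := by rw [hpre]; ring
    have h3 : Real.exp (-(p 0).re) ≤ 1 := by
      rw [h2, Real.exp_le_one_iff]; norm_num
    refine max_le ?_ ?_
    · exact (hA _ h2.ge).trans ((mul_le_of_le_one_right hA0 h3).trans
        (le_add_of_nonneg_right hB0))
    · exact (hB _ h2.ge).trans ((mul_le_of_le_one_right hB0 h3).trans
        (le_add_of_nonneg_left hA0))
  · intro τ hτ
    have hτ' := Set.Ico_subset_Icc_self hτ
    set V := (besselK ν (p τ), besselK (ν + 1) (p τ)) with hVdef
    have e1 : ‖besselK ν (p τ)‖ ≤ ‖V‖ := norm_fst_le V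
    have e2 : ‖besselK (ν + 1) (p τ)‖ ≤ ‖V‖ := norm_snd_le V
    have hc : 0 ≤ (‖ν‖ + 1) / ε := by positivity
    rw [add_zero, hL, add_mul, one_mul]
    refine max_le ?_ ?_
    · dsimp only
      rw [norm_neg, add_comm ‖V‖]
      exact (norm_sub_le _ _).trans (add_le_add ((hdiv τ hτ' _ _ (by linarith)).trans
        (mul_le_mul_of_nonneg_left e1 hc)) e2)
    · dsimp only
      rw [norm_neg]
      refine (norm_sub_le _ _).trans (add_le_add (by rwa [norm_neg]) ((hdiv τ hτ' _ _ ?_).trans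
        (mul_le_mul_of_nonneg_left e2 hc)))
      simpa using norm_add_le ν 1

/-- In each summand the decay `exp(-Im z)` of `K` cancels the growth `exp(Im z)` of `J`, leaving the
power from `J`. -/
theorem exists_norm_besselHankel_le (μ : ℂ) (m : ℤ) {ε : ℝ} (hε : 0 < ε) : ∃ C : ℝ, 0 ≤ C ∧
    ∀ z : ℂ, 0 < z.im → ε ≤ ‖z‖ → ‖besselHankel μ m z‖ ≤ C * ‖z‖ ^ (-(1 / 2) : ℝ) := by
  obtain ⟨A, hA0, hA⟩ := exists_norm_besselK_le (2 * μ + m / 2) hε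
  obtain ⟨B, hB0, hB⟩ := exists_norm_besselK_le (2 * μ - m / 2) hε
  obtain ⟨A', hA'0, hA'⟩ := exists_norm_besselJLog_le (2 * μ + m / 2) (Real.log ε)
  obtain ⟨B', hB'0, hB'⟩ := exists_norm_besselJLog_le (-(2 * μ - m / 2)) (Real.log ε)
  set c := ‖Complex.exp (-(Real.pi * Complex.I / 2 * (2 * μ + m / 2)))‖
  set d := ‖Complex.exp (-(Real.pi * Complex.I / 2 * (2 * μ - m / 2)))‖
  refine ⟨c * A * B' + d * A' * B, by positivity, fun z hz hn => ?_⟩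
  have hz0 : 0 < ‖z‖ := hε.trans_le hn
  have hne : z ≠ 0 := norm_pos_iff.1 hz0
  have hlog : Real.log ε ≤ (Complex.log z).re := by
    rw [Complex.log_re]; exact Real.log_le_log hε hn
  have him : |(Complex.log z).im| ≤ Real.pi := by
    rw [Complex.log_im]; exact Complex.abs_arg_le_pi z
  have hexp : Real.exp (-(Complex.log z).re / 2) = ‖z‖ ^ (-(1 / 2) : ℝ) := by
    rw [Complex.log_re, Real.rpow_def_of_pos hz0]
    congr 1; ring
  have k1 := hA (-Complex.I * z) (by rwa [neg_I_mul_re]) (by simpa using hn)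
  have k2 := hB (Complex.I * starRingEnd ℂ z) (by rwa [I_mul_conj_re]) (by simpa using hn)
  have j1 := hA' (Complex.log z) hlog him
  have j2 := hB' (starRingEnd ℂ (Complex.log z)) (by rwa [Complex.conj_re])
    (by rwa [Complex.conj_im, abs_neg])
  rw [neg_I_mul_re] at k1
  rw [I_mul_conj_re] at k2
  rw [hexp, Complex.exp_log hne, abs_of_pos hz] at j1
  rw [Complex.conj_re, hexp, Complex.exp_conj, Complex.exp_log hne, Complex.conj_im, abs_neg,
    abs_of_pos hz] at j2
  have hone : Real.exp (-z.im) * Real.exp z.im = 1 := by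
    rw [← Real.exp_add, neg_add_cancel, Real.exp_zero]
  have p1 := mul_le_mul k1 j2 (norm_nonneg _) (by positivity)
  have p2 := mul_le_mul j1 k2 (norm_nonneg _) (by positivity)
  rw [besselHankel]
  refine (norm_add_le _ _).trans ?_
  rw [mul_assoc, mul_assoc, norm_mul, norm_mul, norm_mul, norm_mul]
  calc _ ≤ c * (A * Real.exp (-z.im) * (B' * ‖z‖ ^ (-(1 / 2) : ℝ) * Real.exp z.im)) +
        d * (A' * ‖z‖ ^ (-(1 / 2) : ℝ) * Real.exp z.im * (B * Real.exp (-z.im))) := by gcongr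
    _ = _ := by
      linear_combination (c * A * B' + d * A' * B) * ‖z‖ ^ (-(1 / 2) : ℝ) * hone

theorem exists_norm_besselAtRoot_le_of_pos (μ : ℂ) (m : ℤ) {ε : ℝ} (hε : 0 < ε) :
    ∃ C : ℝ, 0 ≤ C ∧ ∀ s : ℂ, 0 < s.im → ε ≤ ‖s‖ →
      ‖besselAtRoot μ m s‖ ≤ C * ‖s‖ ^ (-(1 / 2) : ℝ) := by
  obtain ⟨c, hc⟩ := exists_besselAtRoot_eq m
  have hpi := Real.pi_pos
  obtain ⟨C, hC0, hC⟩ := exists_norm_besselHankel_le μ m (ε := 4 * Real.pi * ε) (by positivity)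
  refine ⟨‖c‖ * (C * (4 * Real.pi) ^ (-(1 / 2) : ℝ)), by positivity, fun s hs hn => ?_⟩
  have hnorm : ‖(4 * Real.pi * s : ℂ)‖ = 4 * Real.pi * ‖s‖ := by
    rw [norm_mul, norm_mul, Complex.norm_ofNat, Complex.norm_real, Real.norm_of_nonneg hpi.le]
  have h := hC (4 * Real.pi * s) (by rw [four_pi_mul_im]; positivity)
    (by rw [hnorm]; gcongr)
  rw [hnorm, Real.mul_rpow (by positivity) (norm_nonneg _)] at h
  rw [hc μ s hs, norm_mul, mul_assoc ‖c‖, mul_assoc C]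
  gcongr

theorem exists_norm_besselAtRoot_le (μ : ℂ) (m : ℤ) {ε : ℝ} (hε : 0 < ε) :
    ∃ C : ℝ, 0 ≤ C ∧ ∀ s : ℂ, s.im ≠ 0 → ε ≤ ‖s‖ →
      ‖besselAtRoot μ m s‖ ≤ C * ‖s‖ ^ (-(1 / 2) : ℝ) := by
  obtain ⟨A, hA0, hA⟩ := exists_norm_besselAtRoot_le_of_pos μ m hε
  obtain ⟨B, hB0, hB⟩ := exists_norm_besselAtRoot_le_of_pos μ (-m) hε
  refine ⟨A + B, by positivity, fun s hs hn => ?_⟩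
  have hp : 0 ≤ ‖s‖ ^ (-(1 / 2) : ℝ) := by positivity
  rw [add_mul]
  rcases lt_or_gt_of_ne hs with h | h
  · have h1 := besselAtRoot_conj μ (-m) hs
    rw [neg_neg] at h1
    rw [← h1]
    refine (hB _ (by simpa using h) (by simpa using hn)).trans ?_
    rw [Complex.norm_conj]
    exact le_add_of_nonneg_left (mul_nonneg hA0 hp)
  · exact (hA s h hn).trans (le_add_of_nonneg_right (mul_nonneg hB0 hp))

theorem continuousOn_besselHankel (μ : ℂ) (m : ℤ) :
    ContinuousOn (besselHankel μ m) {z | 0 < z.im} := by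
  intro z hz
  have hz : 0 < z.im := hz
  refine ContinuousAt.continuousWithinAt ?_
  have hlog : ContinuousAt Complex.log z := continuousAt_clog (Or.inr hz.ne')
  have h1 : ContinuousAt (fun z => besselK (2 * μ + m / 2) (-Complex.I * z)) z :=
    ContinuousAt.comp (f := fun z => -Complex.I * z)
      (hasDerivAt_besselK _ (by rwa [neg_I_mul_re])).continuousAt (by fun_prop)
  have h2 : ContinuousAt (fun z => besselK (2 * μ - m / 2) (Complex.I * starRingEnd ℂ z)) z :=
    ContinuousAt.comp (f := fun z => Complex.I * starRingEnd ℂ z)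
      (hasDerivAt_besselK _ (by rwa [I_mul_conj_re])).continuousAt
      (Complex.continuous_conj.const_mul Complex.I).continuousAt
  have h3 : ContinuousAt (fun z => besselJLog (-(2 * μ - m / 2))
      (starRingEnd ℂ (Complex.log z))) z :=
    (continuous_besselJLog _).continuousAt.comp (Complex.continuous_conj.continuousAt.comp hlog)
  have h4 : ContinuousAt (fun z => besselJLog (2 * μ + m / 2) (Complex.log z)) z :=
    (continuous_besselJLog _).continuousAt.comp hlog
  exact ((continuousAt_const.mul h1).mul h3).add ((continuousAt_const.mul h4).mul h2)

-- The definition by `limUnder` does not show measurability in `s`; the expression through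
-- `besselHankel` is continuous on the upper half plane. Extending by zero lets the two half planes
-- be added afterwards.
open scoped Classical in
theorem exists_measurable_eq_besselAtRoot_of_pos (μ : ℂ) (m : ℤ) :
    ∃ P : ℂ → ℂ, Measurable P ∧ (∀ s, 0 < s.im → P s = besselAtRoot μ m s) ∧
      ∀ s, s.im ≤ 0 → P s = 0 := by
  obtain ⟨c, hc⟩ := exists_besselAtRoot_eq m
  refine ⟨{s : ℂ | 0 < s.im}.piecewise
    (fun s => c * besselHankel μ m (4 * Real.pi * s)) 0, ?_, fun s hs => ?_, fun s hs => ?_⟩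
  · refine ContinuousOn.measurable_piecewise ?_ continuousOn_const
      (measurableSet_lt measurable_const Complex.measurable_im)
    refine continuousOn_const.mul ((continuousOn_besselHankel μ m).comp (by fun_prop) ?_)
    intro s hs
    have hs : 0 < s.im := hs
    have := Real.pi_pos
    change 0 < (4 * Real.pi * s : ℂ).im
    rw [four_pi_mul_im]
    positivity
  · exact (if_pos hs).trans (hc μ s hs).symm
  · exact if_neg hs.not_gt

theorem exists_measurable_eq_besselAtRoot (μ : ℂ) (m : ℤ) :
    ∃ B : ℂ → ℂ, Measurable B ∧ ∀ s, s.im ≠ 0 → B s = besselAtRoot μ m s := by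
  obtain ⟨P, hP, hP1, hP0⟩ := exists_measurable_eq_besselAtRoot_of_pos μ m
  obtain ⟨Q, hQ, hQ1, hQ0⟩ := exists_measurable_eq_besselAtRoot_of_pos μ (-m)
  refine ⟨fun s => P s + Q (starRingEnd ℂ s),
    hP.add (hQ.comp Complex.continuous_conj.measurable), fun s hs => ?_⟩
  have h1 := besselAtRoot_conj μ (-m) hs
  rw [neg_neg] at h1
  dsimp only
  rcases lt_or_gt_of_ne hs with h | h
  · rw [hP0 s h.le, hQ1 _ (by simpa using h), h1, zero_add]
  · rw [hP1 s h, hQ0 _ (by simpa using h.le), add_zero]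

/-! ### The Bessel function on the torus -/

/-- The square root of `-λ² a` that enters `besselTorus`. -/
noncomputable def torusRoot (m : ℤ) (lam a : ℂ) : ℂ :=
  if Even m then (-lam ^ 2 * a) ^ (1 / 2 : ℂ) else Complex.I * lam * a ^ (1 / 2 : ℂ)

theorem cpow_half_sq (z : ℂ) : (z ^ (1 / 2 : ℂ)) ^ 2 = z := by
  rw [one_div]
  exact_mod_cast Complex.cpow_nat_inv_pow z two_ne_zero

theorem torusRoot_sq (m : ℤ) (lam a : ℂ) : torusRoot m lam a ^ 2 = -lam ^ 2 * a := by
  rw [torusRoot]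
  split_ifs
  · exact cpow_half_sq _
  · rw [mul_pow, mul_pow, cpow_half_sq, Complex.I_sq]; ring

theorem torusRoot_im_ne_zero (m : ℤ) {lam a : ℂ} (h : (lam ^ 2 * a).im ≠ 0) :
    (torusRoot m lam a).im ≠ 0 := by
  intro h0
  have h1 := congrArg Complex.im (torusRoot_sq m lam a)
  rw [sq, Complex.mul_im, h0, mul_zero, zero_mul, add_zero, neg_mul, Complex.neg_im] at h1
  exact h (neg_eq_zero.1 h1.symm)

theorem norm_torusRoot (m : ℤ) (lam a : ℂ) : ‖torusRoot m lam a‖ = ‖lam‖ * √‖a‖ := by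
  rw [← sq_eq_sq₀ (norm_nonneg _) (by positivity), ← norm_pow, torusRoot_sq, mul_pow,
    Real.sq_sqrt (norm_nonneg _), norm_mul, norm_neg, norm_pow]

theorem norm_besselTorus (μ : ℂ) (m : ℤ) (lam a : ℂ) :
    ‖besselTorus μ m lam a‖ = ‖lam * a‖ * ‖besselAtRoot μ m (torusRoot m lam a)‖ := by
  rw [besselTorus, torusRoot]
  split_ifs
  · rw [besselBold, norm_mul, Complex.norm_real, norm_norm]
  · have h : ‖a ^ (1 / 2 : ℂ)‖ = √‖a‖ := by
      rw [← sq_eq_sq₀ (norm_nonneg _) (Real.sqrt_nonneg _), ← norm_pow, cpow_half_sq,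
        Real.sq_sqrt (norm_nonneg _)]
    simp only [norm_mul, norm_neg, Complex.norm_I, Complex.norm_real, norm_norm, one_mul, h,
      Real.norm_of_nonneg (Real.sqrt_nonneg _), Real.mul_self_sqrt (norm_nonneg _)]

/-- The prefactor `|λa|` and the decay `|s|^(-1/2)` with `|s| = |λ| |a|^(1/2)` combine to the
exponent `1 - 1/4`. -/
theorem exists_norm_besselTorus_le (μ : ℂ) (m : ℤ) {lam : ℂ} (hlam : lam ≠ 0) {δ : ℝ}
    (hδ : 0 < δ) : ∃ C : ℝ, 0 ≤ C ∧ ∀ a : ℂ, (lam ^ 2 * a).im ≠ 0 → δ ≤ ‖a‖ →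
      ‖besselTorus μ m lam a‖ ≤ C * ‖a‖ ^ (3 / 4 : ℝ) := by
  have hl : 0 < ‖lam‖ := norm_pos_iff.2 hlam
  obtain ⟨C, hC0, hC⟩ := exists_norm_besselAtRoot_le μ m (ε := ‖lam‖ * √δ) (by positivity)
  refine ⟨‖lam‖ * (C * ‖lam‖ ^ (-(1 / 2) : ℝ)), by positivity, fun a ha hn => ?_⟩
  have ha0 : 0 < ‖a‖ := hδ.trans_le hn
  have h := hC (torusRoot m lam a) (torusRoot_im_ne_zero m ha) (by
    rw [norm_torusRoot]
    exact mul_le_mul_of_nonneg_left (Real.sqrt_le_sqrt hn) hl.le)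
  rw [norm_torusRoot, Real.mul_rpow hl.le (Real.sqrt_nonneg _), Real.sqrt_eq_rpow,
    ← Real.rpow_mul ha0.le] at h
  have hpow : ‖a‖ ^ (3 / 4 : ℝ) = ‖a‖ * ‖a‖ ^ (1 / 2 * -(1 / 2) : ℝ) := by
    rw [← Real.rpow_one_add' ha0.le (by norm_num)]
    norm_num
  rw [norm_besselTorus, norm_mul, hpow]
  calc _ ≤ ‖lam‖ * ‖a‖ * (C * (‖lam‖ ^ (-(1 / 2) : ℝ) * ‖a‖ ^ (1 / 2 * -(1 / 2) : ℝ))) :=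
        mul_le_mul_of_nonneg_left h (by positivity)
    _ = _ := by ring

theorem exists_measurable_eq_besselTorus (μ : ℂ) (m : ℤ) (lam : ℂ) :
    ∃ T : ℂ → ℂ, Measurable T ∧ ∀ a, (lam ^ 2 * a).im ≠ 0 → T a = besselTorus μ m lam a := by
  obtain ⟨B, hB, hB1⟩ := exists_measurable_eq_besselAtRoot μ m
  by_cases hm : Even m
  · refine ⟨fun a => (‖lam * a‖ : ℂ) * B (torusRoot m lam a), ?_, fun a ha => ?_⟩
    · simp only [torusRoot, if_pos hm]
      fun_prop
    · dsimp only
      rw [hB1 _ (torusRoot_im_ne_zero m ha), besselTorus, if_pos hm, besselBold, torusRoot,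
        if_pos hm]
  · refine ⟨fun a => -Complex.I * (‖lam‖ : ℂ) * ((Real.sqrt ‖a‖ : ℂ) * a ^ (1 / 2 : ℂ)) *
      B (torusRoot m lam a), ?_, fun a ha => ?_⟩
    · simp only [torusRoot, if_neg hm]
      fun_prop
    · dsimp only
      rw [hB1 _ (torusRoot_im_ne_zero m ha), besselTorus, if_neg hm, torusRoot, if_neg hm]

theorem norm_psi (lam z : ℂ) : ‖psi lam z‖ = 1 := by
  rw [psi, Complex.add_conj,
    show (2 * Real.pi * Complex.I * ((2 * (lam * z).re : ℝ) : ℂ)) =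
      ((2 * Real.pi * (2 * (lam * z).re) : ℝ) : ℂ) * Complex.I by push_cast; ring,
    Complex.norm_exp_ofReal_mul_I]

theorem norm_omega_le (m : ℤ) (c : ℂ) : ‖omega m c‖ ≤ 1 := by
  rw [omega]
  split_ifs
  · simp
  · rw [norm_div, Complex.norm_real, norm_norm]
    exact div_self_le_one _

/-! ### Integrals of negative powers -/

theorem integrableOn_norm_rpow_closedBall :
    IntegrableOn (fun y : ℂ => ‖y‖ ^ (-(3 / 2) : ℝ)) (Metric.closedBall 0 1) := by
  have h1 : IntegrableOn (fun y : ℝ => y ^ (Module.finrank ℝ ℂ - 1) •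
      (Set.Iic 1).indicator (fun y : ℝ => y ^ (-(3 / 2) : ℝ)) y) (Set.Ioi 0) := by
    have h2 : IntegrableOn (fun y : ℝ => y ^ (-(1 / 2) : ℝ)) (Set.Ioc 0 1) :=
      (intervalIntegrable_iff_integrableOn_Ioc_of_le zero_le_one).1
        (intervalIntegral.intervalIntegrable_rpow' (by norm_num))
    have h3 : IntegrableOn ((Set.Iic (1 : ℝ)).indicator fun y : ℝ => y ^ (-(1 / 2) : ℝ))
        (Set.Ioi 0) := by
      rw [IntegrableOn, integrable_indicator_iff measurableSet_Iic, IntegrableOn,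
        Measure.restrict_restrict measurableSet_Iic, Set.inter_comm, Set.Ioi_inter_Iic]
      exact h2
    refine h3.congr_fun (fun y hy => ?_) measurableSet_Ioi
    have hy : 0 < y := hy
    simp only [Complex.finrank_real_complex, Set.indicator, smul_eq_mul, mul_ite, mul_zero]
    refine if_congr Iff.rfl ?_ rfl
    rw [show 2 - 1 = 1 from rfl, pow_one, ← Real.rpow_one_add' hy.le (by norm_num)]
    norm_num
  have h4 := (integrable_fun_norm_addHaar (volume : Measure ℂ)).2 h1
  rw [← integrable_indicator_iff Metric.isClosed_closedBall.measurableSet]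
  convert! h4 using 2 with y
  simp [Set.indicator]

/-- Inside the unit disc about `-c` the integral is a translate of a fixed one; outside it the
integrand is at most `1`. -/
theorem exists_setLIntegral_norm_add_rpow_le : ∃ M : ENNReal, M ≠ ⊤ ∧ ∀ c : ℂ,
    ∫⁻ x in Metric.closedBall (0 : ℂ) 1, ENNReal.ofReal (‖x + c‖ ^ (-(3 / 2) : ℝ)) ≤ M := by
  set F : ℂ → ENNReal := (Metric.closedBall (0 : ℂ) 1).indicator
    fun y => ENNReal.ofReal (‖y‖ ^ (-(3 / 2) : ℝ)) with hF
  have hball : MeasurableSet (Metric.closedBall (0 : ℂ) 1) :=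
    Metric.isClosed_closedBall.measurableSet
  have hmeas : Measurable F := Measurable.indicator (by fun_prop) hball
  refine ⟨(∫⁻ y, F y) + volume (Metric.closedBall (0 : ℂ) 1), ?_, fun c => ?_⟩
  · refine ENNReal.add_ne_top.2 ⟨?_, measure_closedBall_lt_top.ne⟩
    rw [hF, lintegral_indicator hball]
    exact integrableOn_norm_rpow_closedBall.lintegral_lt_top.ne
  · calc _ ≤ ∫⁻ x in Metric.closedBall (0 : ℂ) 1, (F (x + c) + 1) := by
          refine lintegral_mono fun x => ?_
          by_cases hx : ‖x + c‖ ≤ 1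
          · refine le_trans (le_of_eq ?_) le_self_add
            rw [hF, Set.indicator_of_mem (by simpa using hx)]
          · refine le_trans ?_ le_add_self
            rw [ENNReal.ofReal_le_one]
            exact Real.rpow_le_one_of_one_le_of_nonpos (not_le.1 hx).le (by norm_num)
      _ = (∫⁻ x in Metric.closedBall (0 : ℂ) 1, F (x + c)) +
          volume (Metric.closedBall (0 : ℂ) 1) := by
          rw [lintegral_add_right _ measurable_const, setLIntegral_one]
      _ ≤ (∫⁻ x, F (x + c)) + volume (Metric.closedBall (0 : ℂ) 1) := by
          gcongr
          exact Measure.restrict_le_self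
      _ = _ := by rw [lintegral_add_right_eq_self]

/-! ### Haar measure on `GL₂(ℂ)` -/

instance : LocallyCompactSpace (Matrix (Fin 2) (Fin 2) ℂ) :=
  inferInstanceAs (LocallyCompactSpace (Fin 2 → Fin 2 → ℂ))

instance : SecondCountableTopology (Matrix (Fin 2) (Fin 2) ℂ) :=
  inferInstanceAs (SecondCountableTopology (Fin 2 → Fin 2 → ℂ))

instance : SecondCountableTopology (GL (Fin 2) ℂ) :=
  haveI : SecondCountableTopology (Matrix (Fin 2) (Fin 2) ℂ)ᵐᵒᵖ :=
    MulOpposite.opHomeomorph.symm.isInducing.secondCountableTopology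
  Units.isEmbedding_embedProduct.isInducing.secondCountableTopology

theorem continuous_entry (i j : Fin 2) : Continuous fun g : GL (Fin 2) ℂ => g i j :=
  Units.continuous_val.matrix_elem i j

theorem continuous_det_coe :
    Continuous fun g : GL (Fin 2) ℂ => (g : Matrix (Fin 2) (Fin 2) ℂ).det :=
  Units.continuous_val.matrix_det

/-- The lower triangular unipotent matrix with lower left entry `x`. -/
noncomputable def lowerElt (x : ℂ) : GL (Fin 2) ℂ where
  val := !![1, 0; x, 1]
  inv := !![1, 0; -x, 1]
  val_inv := by simp [Matrix.one_fin_two]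
  inv_val := by simp [Matrix.one_fin_two]

theorem continuous_lowerElt : Continuous lowerElt := by
  rw [Units.continuous_iff]
  constructor
  · refine continuous_matrix fun i j => ?_
    fin_cases i <;> fin_cases j <;> simp [lowerElt] <;> fun_prop
  · refine continuous_matrix fun i j => ?_
    fin_cases i <;> fin_cases j <;> simp [lowerElt] <;> fun_prop

theorem lowerElt_mul_apply_zero_zero (x : ℂ) (g : GL (Fin 2) ℂ) :
    (lowerElt x * g) 0 0 = g 0 0 := by
  simp [lowerElt, Matrix.mul_apply, Fin.sum_univ_two]

theorem lowerElt_mul_apply_one_zero (x : ℂ) (g : GL (Fin 2) ℂ) :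
    (lowerElt x * g) 1 0 = x * g 0 0 + g 1 0 := by
  simp [lowerElt, Matrix.mul_apply, Fin.sum_univ_two]

section Haar

variable [MeasurableSpace (GL (Fin 2) ℂ)] [BorelSpace (GL (Fin 2) ℂ)]

theorem measurable_cell_coordinate : Measurable fun g : GL (Fin 2) ℂ =>
    -(g : Matrix (Fin 2) (Fin 2) ℂ).det / (g 1 0) ^ 2 :=
  continuous_det_coe.measurable.neg.div ((continuous_entry 1 0).measurable.pow_const 2)

/-- Left translation by `t(1 + iτ)`, `τ` real, multiplies the coordinate by `1 + iτ`, and a nonzero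
number becomes real for at most one `τ`. So the translates of this set are pairwise disjoint and of
equal measure; uncountably many of them cannot have positive measure. -/
theorem measure_cell_coordinate_real_eq_zero (ν : Measure (GL (Fin 2) ℂ)) [ν.IsHaarMeasure]
    {c : ℂ} (hc : c ≠ 0) :
    ν {g : GL (Fin 2) ℂ | g 1 0 ≠ 0 ∧ (c * (-(g : Matrix (Fin 2) (Fin 2) ℂ).det / (g 1 0) ^ 2)).im = 0} = 0 := by
  set N : Set (GL (Fin 2) ℂ) :=
    {g : GL (Fin 2) ℂ | g 1 0 ≠ 0 ∧ (c * (-(g : Matrix (Fin 2) (Fin 2) ℂ).det / (g 1 0) ^ 2)).im = 0} with hN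
  have hNm : MeasurableSet N := by
    refine MeasurableSet.inter (isOpen_ne_fun (continuous_entry 1 0)
      continuous_const).measurableSet (measurableSet_eq_fun (Complex.measurable_im.comp
        (measurable_cell_coordinate.const_mul c)) measurable_const)
  have hu : ∀ t : ℝ, (1 + t * Complex.I : ℂ) ≠ 0 := fun t h => by
    simpa using congrArg Complex.re h
  let T : ℝ → GL (Fin 2) ℂ := fun t => tElt (Units.mk0 _ (hu t))
  have hT10 : ∀ t g, (T t * g) 1 0 = g 1 0 := fun t g => by
    simp [T, tElt, borelElt, GeneralLinearGroup.mkOfDetNeZero, Matrix.mul_apply, Fin.sum_univ_two]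
  have hTdet : ∀ t g, ((T t * g : GL (Fin 2) ℂ) : Matrix (Fin 2) (Fin 2) ℂ).det =
      (1 + t * Complex.I) * (g : Matrix (Fin 2) (Fin 2) ℂ).det := fun t g => by
    rw [Units.val_mul, Matrix.det_mul]
    simp [T, tElt, borelElt, GeneralLinearGroup.mkOfDetNeZero]
  by_contra hne
  have hcount := Measure.countable_meas_pos_of_disjoint_iUnion (μ := ν)
    (As := fun t : ℝ => (fun g => T t * g) ⁻¹' N)
    (fun t => (continuous_const_mul (T t)).measurable hNm) ?_
  · have huniv : {t : ℝ | 0 < ν ((fun g => T t * g) ⁻¹' N)} = Set.univ := by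
      ext t
      simp only [measure_preimage_mul, Set.mem_ofPred_eq, Set.mem_univ, iff_true]
      exact pos_iff_ne_zero.2 hne
    rw [huniv] at hcount
    exact Set.not_countable_univ hcount
  · intro t t' htt'
    refine Set.disjoint_left.2 fun g hg hg' => htt' ?_
    obtain ⟨h10, h1⟩ := hg
    obtain ⟨-, h2⟩ := hg'
    rw [hT10] at h10
    rw [hT10, hTdet] at h1 h2
    set x := c * (-(g : Matrix (Fin 2) (Fin 2) ℂ).det / (g 1 0) ^ 2) with hx
    have hx0 : x ≠ 0 :=
      mul_ne_zero hc (div_ne_zero (neg_ne_zero.2 g.det_ne_zero) (pow_ne_zero 2 h10))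
    have key : ∀ t : ℝ, (c * (-((1 + t * Complex.I) * (g : Matrix (Fin 2) (Fin 2) ℂ).det) /
        (g 1 0) ^ 2)).im = x.im + t * x.re := by
      intro t
      rw [show c * (-((1 + t * Complex.I) * (g : Matrix (Fin 2) (Fin 2) ℂ).det) /
        (g 1 0) ^ 2) = x + t * (Complex.I * x) by rw [hx]; ring, Complex.add_im,
        Complex.im_ofReal_mul, Complex.I_mul_im]
    rw [key] at h1 h2
    by_contra htne
    have h3 : x.re = 0 := by
      have : (t - t') * x.re = 0 := by linear_combination h1 - h2
      exact (mul_eq_zero.1 this).resolve_left (sub_ne_zero.2 htne)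
    rw [h3, mul_zero, add_zero] at h1
    exact hx0 (Complex.ext h3 h1)

/-- Near a point with lower left entry zero, the upper left entry `p` is bounded away from zero.
Translation by `lowerElt x` fixes `p` and sends `r` to `r + x p`. By invariance and Tonelli the
integral may be averaged over `x` in the unit disc, and the integral in `x` alone is bounded
uniformly in `g`. -/
theorem exists_nhds_setLIntegral_entry_rpow_lt_top (ν : Measure (GL (Fin 2) ℂ))
    [ν.IsHaarMeasure] (g₀ : GL (Fin 2) ℂ) : ∃ U ∈ 𝓝 g₀,
      ∫⁻ g in U, ENNReal.ofReal (‖g 1 0‖ ^ (-(3 / 2) : ℝ)) ∂ν < ⊤ := by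
  obtain ⟨K, hK, hKn⟩ := exists_compact_mem_nhds g₀
  by_cases h0 : g₀ 1 0 = 0
  · have hp : g₀ 0 0 ≠ 0 := by
      intro hp
      refine g₀.det_ne_zero ?_
      rw [Matrix.det_fin_two]
      simp [h0, hp]
    have hp' : 0 < ‖g₀ 0 0‖ / 2 := half_pos (norm_pos_iff.2 hp)
    set U := K ∩ {g | ‖g₀ 0 0‖ / 2 < ‖g 0 0‖} with hU
    have hopen : IsOpen {g : GL (Fin 2) ℂ | ‖g₀ 0 0‖ / 2 < ‖g 0 0‖} :=
      isOpen_lt continuous_const (continuous_entry 0 0).norm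
    have hUm : MeasurableSet U := hK.measurableSet.inter hopen.measurableSet
    refine ⟨U, Filter.inter_mem hKn (hopen.mem_nhds (half_lt_self (norm_pos_iff.2 hp))), ?_⟩
    set H : GL (Fin 2) ℂ → ENNReal :=
      U.indicator fun g => ENNReal.ofReal (‖g 1 0‖ ^ (-(3 / 2) : ℝ)) with hH
    have hHm : Measurable H := by
      exact Measurable.indicator
        ((continuous_entry 1 0).measurable.norm.pow_const _).ennreal_ofReal hUm
    set ball := Metric.closedBall (0 : ℂ) 1
    -- A compact set containing every `g` that some translation with `x` in the disc moves into `K`;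
    -- outside it the average vanishes.
    set K' := (fun p : ℂ × GL (Fin 2) ℂ => (lowerElt p.1)⁻¹ * p.2) '' (ball ×ˢ K) with hK'
    have hK'c : IsCompact K' := by
      refine ((isCompact_closedBall _ _).prod hK).image ?_
      exact (continuous_lowerElt.comp continuous_fst).inv.mul continuous_snd
    obtain ⟨M, hM, hMc⟩ := exists_setLIntegral_norm_add_rpow_le
    set A := ENNReal.ofReal ((‖g₀ 0 0‖ / 2) ^ (-(3 / 2) : ℝ)) * M with hA
    have hinner : ∀ g, ∫⁻ x in ball, H (lowerElt x * g) ≤ K'.indicator (fun _ => A) g := by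
      intro g
      by_cases hg : g ∈ K' ∧ ‖g₀ 0 0‖ / 2 < ‖g 0 0‖
      · rw [Set.indicator_of_mem hg.1]
        have hg0 : g 0 0 ≠ 0 := norm_pos_iff.1 (hp'.trans hg.2)
        calc ∫⁻ x in ball, H (lowerElt x * g)
            ≤ ∫⁻ x in ball, ENNReal.ofReal ((‖g₀ 0 0‖ / 2) ^ (-(3 / 2) : ℝ)) *
                ENNReal.ofReal (‖x + g 1 0 / g 0 0‖ ^ (-(3 / 2) : ℝ)) := by
              refine lintegral_mono fun x => (Set.indicator_le_self _ _ _).trans ?_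
              rw [← ENNReal.ofReal_mul (by positivity), lowerElt_mul_apply_one_zero,
                show x * g 0 0 + g 1 0 = g 0 0 * (x + g 1 0 / g 0 0) by field_simp,
                norm_mul, Real.mul_rpow (norm_nonneg _) (norm_nonneg _)]
              refine ENNReal.ofReal_le_ofReal (mul_le_mul_of_nonneg_right ?_ (by positivity))
              exact Real.rpow_le_rpow_of_nonpos hp' hg.2.le (by norm_num)
          _ ≤ A := by
              rw [lintegral_const_mul' _ _ ENNReal.ofReal_ne_top, hA]
              gcongr
              exact hMc _
      · refine le_of_eq_of_le ?_ zero_le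
        refine (setLIntegral_congr_fun Metric.isClosed_closedBall.measurableSet
          (g := fun _ => 0) fun x hx => ?_).trans (by simp)
        refine Set.indicator_of_notMem (fun hxU => hg ⟨?_, ?_⟩) _
        · exact ⟨(x, lowerElt x * g), ⟨hx, hxU.1⟩, inv_mul_cancel_left _ _⟩
        · have := hxU.2
          rwa [Set.mem_ofPred_eq, lowerElt_mul_apply_zero_zero] at this
    have hswap : ∫⁻ x in ball, ∫⁻ g, H (lowerElt x * g) ∂ν =
        ∫⁻ g, (∫⁻ x in ball, H (lowerElt x * g)) ∂ν := by
      refine lintegral_lintegral_swap (Measurable.aemeasurable ?_)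
      exact hHm.comp
        ((continuous_lowerElt.comp continuous_fst).mul continuous_snd).measurable
    simp only [lintegral_mul_left_eq_self] at hswap
    rw [setLIntegral_const] at hswap
    have hfin : (∫⁻ g, H g ∂ν) * volume ball < ⊤ := by
      rw [hswap]
      refine (lintegral_mono hinner).trans_lt ?_
      rw [lintegral_indicator hK'c.measurableSet, setLIntegral_const]
      exact ENNReal.mul_lt_top (ENNReal.mul_lt_top ENNReal.ofReal_lt_top hM.lt_top)
        hK'c.measure_lt_top
    rw [← lintegral_indicator hUm]
    refine lt_of_not_ge fun htop => hfin.ne ?_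
    rw [← hH] at htop
    rw [top_le_iff.1 htop]
    exact ENNReal.top_mul (Metric.measure_closedBall_pos _ _ one_pos).ne'
  · have hr : 0 < ‖g₀ 1 0‖ / 2 := half_pos (norm_pos_iff.2 h0)
    have hopen : IsOpen {g : GL (Fin 2) ℂ | ‖g₀ 1 0‖ / 2 < ‖g 1 0‖} :=
      isOpen_lt continuous_const (continuous_entry 1 0).norm
    refine ⟨K ∩ {g | ‖g₀ 1 0‖ / 2 < ‖g 1 0‖},
      Filter.inter_mem hKn (hopen.mem_nhds (half_lt_self (norm_pos_iff.2 h0))), ?_⟩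
    calc _ ≤ ∫⁻ g in K ∩ {g | ‖g₀ 1 0‖ / 2 < ‖g 1 0‖},
          ENNReal.ofReal ((‖g₀ 1 0‖ / 2) ^ (-(3 / 2) : ℝ)) ∂ν := by
          refine setLIntegral_mono measurable_const fun g hg => ENNReal.ofReal_le_ofReal ?_
          exact Real.rpow_le_rpow_of_nonpos hr (le_of_lt hg.2) (by norm_num)
      _ < ⊤ := by
          rw [setLIntegral_const]
          exact ENNReal.mul_lt_top ENNReal.ofReal_lt_top
            ((measure_mono Set.inter_subset_left).trans_lt hK.measure_lt_top)

/-! ### Measurability, local bound and integrability of `besselFn` on the group -/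

theorem ae_cell_coordinate_im_ne_zero (ν : Measure (GL (Fin 2) ℂ)) [ν.IsHaarMeasure]
    {c : ℂ} (hc : c ≠ 0) : ∀ᵐ g : GL (Fin 2) ℂ ∂ν, g 1 0 ≠ 0 →
      (c * (-(g : Matrix (Fin 2) (Fin 2) ℂ).det / (g 1 0) ^ 2)).im ≠ 0 := by
  rw [ae_iff]
  convert! measure_cell_coordinate_real_eq_zero ν hc using 2
  ext g
  simp

theorem aestronglyMeasurable_besselFn (μ : ℂ) (m : ℤ) {lam : ℂ} (hlam : lam ≠ 0)
    (ν : Measure (GL (Fin 2) ℂ)) [ν.IsHaarMeasure] :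
    AEStronglyMeasurable (besselFn μ m lam) ν := by
  obtain ⟨T, hT, hT1⟩ := exists_measurable_eq_besselTorus μ m lam
  have h00 := (continuous_entry 0 0).measurable
  have h10 := (continuous_entry 1 0).measurable
  have h11 := (continuous_entry 1 1).measurable
  have hpsi : Measurable (psi lam) := by
    have h : Continuous (psi lam) := by
      have := Complex.continuous_conj
      unfold psi
      fun_prop
    exact h.measurable
  have homega : Measurable (omega m) := by
    by_cases hm : Even m
    · have : omega m = fun _ => 1 := funext fun c => if_pos hm
      rw [this]; exact measurable_const
    · have : omega m = fun c => c / (‖c‖ : ℂ) := funext fun c => if_neg hm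
      rw [this]; fun_prop
  have hmeas : Measurable fun g : GL (Fin 2) ℂ => if g 1 0 = 0 then 0
      else psi lam (g 0 0 / g 1 0) * psi lam (g 1 1 / g 1 0) * omega m (g 1 0) *
        T (-(g : Matrix (Fin 2) (Fin 2) ℂ).det / (g 1 0) ^ 2) :=
    Measurable.ite (h10 (measurableSet_singleton 0)) measurable_const
      ((((hpsi.comp (h00.div h10)).mul (hpsi.comp (h11.div h10))).mul (homega.comp h10)).mul
        (hT.comp measurable_cell_coordinate))
  refine hmeas.aestronglyMeasurable.congr ?_
  filter_upwards [ae_cell_coordinate_im_ne_zero ν (pow_ne_zero 2 hlam)] with g hg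
  rw [besselFn]
  split_ifs with h
  · rfl
  · rw [hT1 _ (hg h)]

theorem exists_norm_besselFn_le (μ : ℂ) (m : ℤ) {lam : ℂ} (hlam : lam ≠ 0)
    (ν : Measure (GL (Fin 2) ℂ)) [ν.IsHaarMeasure] {K : Set (GL (Fin 2) ℂ)} (hK : IsCompact K) :
    ∃ C : ℝ, ∀ᵐ g : GL (Fin 2) ℂ ∂ν, g ∈ K → ‖besselFn μ m lam g‖ ≤ C * ‖g 1 0‖ ^ (-(3 / 2) : ℝ) := by
  obtain ⟨D, hD⟩ := hK.exists_bound_of_continuousOn continuous_det_coe.continuousOn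
  obtain ⟨D', hD'⟩ := hK.exists_bound_of_continuousOn
    (continuous_det_coe.inv₀ fun g => g.det_ne_zero).continuousOn
  obtain ⟨R, hR⟩ := hK.exists_bound_of_continuousOn (continuous_entry 1 0).continuousOn
  have hd : 0 < (|D'| + 1)⁻¹ := by positivity
  have hR' : 0 < (|R| + 1) := by positivity
  -- This `δ` is a lower bound for `|det g| / |r|²` on `K`; adding `1` to `|D'|` and `|R|` keeps it
  -- positive.
  obtain ⟨C, hC0, hC⟩ := exists_norm_besselTorus_le μ m hlam
    (δ := (|D'| + 1)⁻¹ / (|R| + 1) ^ 2) (by positivity)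
  refine ⟨C * |D| ^ (3 / 4 : ℝ), ?_⟩
  filter_upwards [ae_cell_coordinate_im_ne_zero ν (pow_ne_zero 2 hlam)] with g hg hgK
  by_cases h : g 1 0 = 0
  · rw [besselFn, if_pos h, norm_zero]; positivity
  have hr : 0 < ‖g 1 0‖ := norm_pos_iff.2 h
  have hdet : 0 < ‖(g : Matrix (Fin 2) (Fin 2) ℂ).det‖ := norm_pos_iff.2 g.det_ne_zero
  have hlow : (|D'| + 1)⁻¹ ≤ ‖(g : Matrix (Fin 2) (Fin 2) ℂ).det‖ := by
    refine inv_le_of_inv_le₀ hdet ?_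
    rw [← norm_inv]
    exact (hD' g hgK).trans ((le_abs_self _).trans (le_add_of_nonneg_right zero_le_one))
  have hnorm : ‖-(g : Matrix (Fin 2) (Fin 2) ℂ).det / (g 1 0) ^ 2‖ =
      ‖(g : Matrix (Fin 2) (Fin 2) ℂ).det‖ / ‖g 1 0‖ ^ 2 := by
    rw [norm_div, norm_neg, norm_pow]
  have h1 := hC _ (hg h) (by
    rw [hnorm]
    refine div_le_div₀ hdet.le hlow (by positivity) ?_
    have := (hR g hgK).trans ((le_abs_self _).trans (le_add_of_nonneg_right zero_le_one))
    gcongr)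
  have h2 : (‖(g : Matrix (Fin 2) (Fin 2) ℂ).det‖ / ‖g 1 0‖ ^ 2) ^ (3 / 4 : ℝ) ≤
      |D| ^ (3 / 4 : ℝ) * ‖g 1 0‖ ^ (-(3 / 2) : ℝ) := by
    rw [Real.div_rpow (norm_nonneg _) (by positivity), div_eq_mul_inv, ← Real.rpow_natCast,
      ← Real.rpow_mul hr.le, ← Real.rpow_neg hr.le]
    norm_num
    gcongr
    exact (hD g hgK).trans (le_abs_self _)
  rw [besselFn, if_neg h, norm_mul, norm_mul, norm_mul, norm_psi, norm_psi, one_mul, one_mul]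
  calc _ ≤ 1 * ‖besselTorus μ m lam (-(g : Matrix (Fin 2) (Fin 2) ℂ).det / (g 1 0) ^ 2)‖ :=
        mul_le_mul_of_nonneg_right (norm_omega_le _ _) (norm_nonneg _)
    _ ≤ C * (|D| ^ (3 / 4 : ℝ) * ‖g 1 0‖ ^ (-(3 / 2) : ℝ)) := by
        rw [one_mul]
        rw [hnorm] at h1
        exact h1.trans (mul_le_mul_of_nonneg_left h2 hC0)
    _ = _ := by ring

/-- The Bessel function is locally integrable for every complex `μ`: the decay of `besselAtRoot` at
infinity that is needed near the complement of the open cell holds without restriction on `μ`,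
so unitarity plays no role. -/
theorem locallyIntegrable_besselFn (μ : ℂ) (m : ℤ) {lam : ℂ} (hlam : lam ≠ 0)
    (ν : Measure (GL (Fin 2) ℂ)) [ν.IsHaarMeasure] :
    LocallyIntegrable (besselFn μ m lam) ν := by
  intro g₀
  obtain ⟨K, hK, hKn⟩ := exists_compact_mem_nhds g₀
  obtain ⟨U, hU, hfin⟩ := exists_nhds_setLIntegral_entry_rpow_lt_top ν g₀
  obtain ⟨C, hC⟩ := exists_norm_besselFn_le μ m hlam ν hK
  -- `U` need not be measurable; its interior is, and it is still a neighbourhood.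
  refine ⟨K ∩ interior U, Filter.inter_mem hKn (interior_mem_nhds.2 hU), ?_⟩
  have hint : IntegrableOn (fun g : GL (Fin 2) ℂ => ‖g 1 0‖ ^ (-(3 / 2) : ℝ))
      (K ∩ interior U) ν := by
    have hm : Measurable fun g : GL (Fin 2) ℂ => ‖g 1 0‖ ^ (-(3 / 2) : ℝ) :=
      (continuous_entry 1 0).measurable.norm.pow_const _
    refine ⟨hm.aestronglyMeasurable, ?_⟩
    rw [hasFiniteIntegral_iff_ofReal (Eventually.of_forall fun g => by positivity)]
    exact (lintegral_mono_set (Set.inter_subset_right.trans interior_subset)).trans_lt hfin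
  refine (hint.const_mul C).mono' (aestronglyMeasurable_besselFn μ m hlam ν).restrict ?_
  rw [ae_restrict_iff' (hK.measurableSet.inter isOpen_interior.measurableSet)]
  filter_upwards [hC] with g hg hgK
  exact hg hgK.1

end Haar

theorem IsSmooth.continuous {f : GL (Fin 2) ℂ → ℂ} (hf : IsSmooth f) : Continuous f := by
  obtain ⟨F, hF, h⟩ := hf
  rw [funext h]
  exact hF.continuousOn.comp_continuous
    (continuous_pi fun i => continuous_pi fun j => continuous_entry i j)
    fun g => g.det_ne_zero

end BesselGL2

theorem proposition4p2
    {H : Type*} [NormedAddCommGroup H] [InnerProductSpace ℂ H] [CompleteSpace H]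
    (π : GL (Fin 2) ℂ →* (H ≃ₗᵢ[ℂ] H)) (hπ : BesselGL2.IsIrreducibleUnitary π)
    (μ : ℂ) (m : ℤ) (hμm : BesselGL2.IsPi π μ m)
    (lam : ℂ) (hlam : lam ≠ 0)
    [MeasurableSpace (GL (Fin 2) ℂ)] [BorelSpace (GL (Fin 2) ℂ)]
    (ν : Measure (GL (Fin 2) ℂ)) [ν.IsHaarMeasure] :
    LocallyIntegrable (BesselGL2.besselFn μ m lam) ν ∧
      ∀ f : GL (Fin 2) ℂ → ℂ, BesselGL2.IsSmooth f → HasCompactSupport f →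
        Integrable (fun g => f g * BesselGL2.besselFn μ m lam g) ν := by
  have h := BesselGL2.locallyIntegrable_besselFn μ m hlam ν
  refine ⟨h, fun f hf hs => ?_⟩
  simpa only [smul_eq_mul] using h.integrable_smul_left_of_hasCompactSupport hf.continuous hs
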